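/- Let $\Bbbk$ be a field of arbitrary characteristic and let $c \ge 7$. Let $S = \Bbbk[x_0,\dots,x_{c-1}]$ with its standard grading, and let $D = \Bbbk[y_0,\dots,y_{c-1}]$ be the $S$-module of inverse polynomials, on which $S$ acts by contraction: $x^\alpha\cdot y^\beta = y^{\beta-\alpha}$ if $\beta_i \ge \alpha_i$ for all $i$, and $x^\alpha\cdot y^\beta = 0$ otherwise, extended linearly. With indices read modulo $c$, put $$F = \sum_{i\in\mathbb{Z}/c\mathbb{Z}} y_i\,y_{i+1}\,y_{i+2}^2 \in D, \qquad I_F = (0:_S F) = \{p\in S : p\cdot F = 0\}, \qquad R = S/I_F .$$ Then: 1. $R$ is quadratic (that is, $I_F$ is generated by homogeneous polynomials of degree $2$) and Gorenstein, with $\operatorname{codim} R = \operatorname{ht} I_F = c$ and Castelnuovo–Mumford regularity $\operatorname{reg} R = \max\{j : \operatorname{Tor}_i^S(R,\Bbbk)_{i+j}\neq 0 \text{ for some } i\} = 4$. 2. The $h$-vector of $R$ is $(1,c,2c,c,1)$. 3. $R$ is not Koszul: $\Bbbk = R/R_+$ has no linear graded free resolution over $R$. 4. For $i \in \mathbb{Z}/c\mathbb{Z}$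 let $q_i = x_i^2 - x_{i-1}x_{i-3}$, and let $m_1,\dots,m_s$ be the monomials $x_ix_j$ such that the distance of $i$ and $j$ on the cycle $\mathbb{Z}/c\mathbb{Z}$ is at least $3$. The quadrics $q_0,\dots,q_{c-1},m_1,\dots,m_s$ are linearly independent over $\Bbbk$ and generate $I_F$. The vector $u$ with coordinate $x_{i-1}x_{i-2}$ at $q_i$ for each $i$ and coordinate $0$ at each $m_j$ is a quadratic syzygy on these generators, that is, $\sum_{i} x_{i-1}x_{i-2}\,q_i = 0$, and $u$ does not lie in the $S$-module generated by the linear syzygies and the Koszul syzygies on $q_0,\dots,q_{c-1},m_1,\dots,m_s$. -/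

import Mathlib

open MvPolynomial
open scoped TensorProduct

universe u

noncomputable section

namespace QuadGor

/-! ### Inverse polynomials, the contraction action and annihilator ideals -/

section Contraction

variable {σ : Type} {k : Type u} [Field k]

/-- Contraction by the monomial `x ^ α`, as a `k`-linear operator on inverse polynomials:
`y ^ β` is sent to `y ^ (β - α)` if `α ≤ β` and to `0` otherwise. -/
def contractMonomial (α : σ →₀ ℕ) : Module.End k (MvPolynomial σ k) where
  toFun G := G.divMonomial α
  map_add' G H := by
    ext β
    simp [coeff_divMonomial]
  map_smul' a G := by
    ext β
    simp [coeff_divMonomial]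

/-- The action of `S = k[x]` on `D = k[y]` by contraction, extended linearly from monomials. -/
def contraction : MvPolynomial σ k →ₐ[k] Module.End k (MvPolynomial σ k) :=
  AddMonoidAlgebra.lift k (Module.End k (MvPolynomial σ k)) (σ →₀ ℕ)
    { toFun := fun α => contractMonomial (Multiplicative.toAdd α)
      map_one' := by
        ext G β
        simp [contractMonomial, coeff_divMonomial]
      map_mul' := by
        intro α β
        refine LinearMap.ext fun G => MvPolynomial.ext _ _ fun γ => ?_
        simp [contractMonomial, coeff_divMonomial, Module.End.mul_apply, add_left_comm, add_assoc] }

theorem contraction_monomial (α β : σ →₀ ℕ) (a b : k) [Decidable (α ≤ β)] :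
    contraction (monomial α a) (monomial β b) =
      if α ≤ β then monomial (β - α) (a * b) else 0 := by
  have h : contraction (monomial α a : MvPolynomial σ k) = a • contractMonomial α :=
    AddMonoidAlgebra.lift_single _ _ _
  classical
  rw [h]
  ext γ
  by_cases hab : α ≤ β
  · simp [contractMonomial, coeff_divMonomial, coeff_monomial, hab, eq_comm (a := β),
      eq_tsub_iff_add_eq_of_le hab, eq_comm (a := β - α), add_comm γ α]
  · have : β ≠ α + γ := fun e => hab (e ▸ le_self_add)
    simp [contractMonomial, coeff_divMonomial, coeff_monomial, hab, this]

/-- The ideal `(0 :_S G)` of polynomials that annihilate the inverse polynomial `G`. -/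
def annIdeal (G : MvPolynomial σ k) : Ideal (MvPolynomial σ k) where
  carrier := {p | contraction p G = 0}
  add_mem' {p q} hp hq := by
    have hp' : contraction p G = 0 := hp
    have hq' : contraction q G = 0 := hq
    show contraction (p + q) G = 0
    rw [map_add, LinearMap.add_apply, hp', hq', add_zero]
  zero_mem' := by
    show contraction 0 G = 0
    rw [map_zero, LinearMap.zero_apply]
  smul_mem' q p hp := by
    have hp' : contraction p G = 0 := hp
    show contraction (q * p) G = 0
    rw [map_mul, Module.End.mul_apply, hp', map_zero]

end Contraction

/-! ### Graded free resolutions and graded Tor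

A graded object is given by the family `ℕ → Submodule k _` of its homogeneous components. -/

section Graded

variable {k A : Type u} [Field k] [CommRing A] [Algebra k A]

/-- The ideal `A₊` generated by the homogeneous elements of positive degree. -/
def irrelevantIdeal (𝒜 : ℕ → Submodule k A) : Ideal A :=
  Ideal.span {a | ∃ n, 0 < n ∧ a ∈ 𝒜 n}

/-- The grading induced on a quotient ring by an ideal. -/
def quotientGrading (𝒜 : ℕ → Submodule k A) (I : Ideal A) (n : ℕ) : Submodule k (A ⧸ I) :=
  (𝒜 n).map (Ideal.Quotient.mkₐ k I).toLinearMap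

/-- A resolution `⋯ → F₂ → F₁ → F₀ → M → 0` of the graded `A`-module `M` by graded free modules
`Fᵢ`, with homogeneous maps of degree `0`. Here `Fᵢ` has a basis indexed by `ι i`, and the basis
element `a` has degree `deg i a`, so that `Fᵢ` is the direct sum of the `A(-deg i a)`. -/
structure GradedFreeResolution (𝒜 : ℕ → Submodule k A) {M : Type u} [AddCommGroup M]
    [Module k M] [Module A M] (ℳ : ℕ → Submodule k M) where
  ι : ℕ → Type u
  deg : (i : ℕ) → ι i → ℕ
  d : (i : ℕ) → (ι (i + 1) →₀ A) →ₗ[A] (ι i →₀ A)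
  ε : (ι 0 →₀ A) →ₗ[A] M
  d_mem : ∀ i (b : ι (i + 1)) (a : ι i) (n : ℕ), deg i a + n = deg (i + 1) b →
    d i (Finsupp.single b 1) a ∈ 𝒜 n
  d_eq_zero : ∀ i (b : ι (i + 1)) (a : ι i), deg (i + 1) b < deg i a →
    d i (Finsupp.single b 1) a = 0
  ε_mem : ∀ a : ι 0, ε (Finsupp.single a 1) ∈ ℳ (deg 0 a)
  ε_surjective : Function.Surjective ε
  exact_zero : Function.Exact (d 0) ε
  exact_succ : ∀ i, Function.Exact (d (i + 1)) (d i)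

namespace GradedFreeResolution

variable {𝒜 : ℕ → Submodule k A} {M : Type u} [AddCommGroup M] [Module k M] [Module A M]
  {ℳ : ℕ → Submodule k M}

/-- The resolution is linear if `Fᵢ` is generated in degree `i` for every `i`. -/
def IsLinear (F : GradedFreeResolution 𝒜 ℳ) : Prop :=
  ∀ i (a : F.ι i), F.deg i a = i

variable (F : GradedFreeResolution 𝒜 ℳ) {N : Type u} [AddCommGroup N] [Module k N] [Module A N]
  [IsScalarTower k A N] (𝒩 : ℕ → Submodule k N)

/-- The component of degree `j` of the graded module `N ⊗ Fᵢ`. -/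
def tensorComponent (i j : ℕ) : Submodule k (N ⊗[A] (F.ι i →₀ A)) :=
  Submodule.span k {t | ∃ (a : F.ι i) (n : ℕ) (x : N), n + F.deg i a = j ∧ x ∈ 𝒩 n ∧
    t = x ⊗ₜ[A] Finsupp.single a 1}

/-- The cycles in `N ⊗ Fᵢ`. -/
def cycles (N : Type u) [AddCommGroup N] [Module A N] :
    (i : ℕ) → Submodule A (N ⊗[A] (F.ι i →₀ A))
  | 0 => ⊤
  | i + 1 => LinearMap.ker ((F.d i).lTensor N)

/-- The boundaries in `N ⊗ Fᵢ`. -/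
def boundaries (N : Type u) [AddCommGroup N] [Module A N] (i : ℕ) :
    Submodule A (N ⊗[A] (F.ι i →₀ A)) :=
  LinearMap.range ((F.d i).lTensor N)

/-- The cycles of degree `j` in `N ⊗ Fᵢ`. -/
def cyclesComponent (i j : ℕ) : Submodule k (N ⊗[A] (F.ι i →₀ A)) :=
  (F.cycles N i).restrictScalars k ⊓ F.tensorComponent 𝒩 i j

/-- The component `Torᵢ(N, M)ⱼ`, computed from the resolution `F` of `M`: cycles of degree `j`
in `N ⊗ Fᵢ` modulo boundaries. -/
abbrev TorComponent (i j : ℕ) : Type u :=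
  F.cyclesComponent 𝒩 i j ⧸
    Submodule.comap (F.cyclesComponent 𝒩 i j).subtype ((F.boundaries N i).restrictScalars k)

/-- The dimension of `Torᵢ(N, M)ⱼ` over `k`. -/
def torDim (i j : ℕ) : ℕ :=
  Module.finrank k (F.TorComponent 𝒩 i j)

end GradedFreeResolution

/-- `A` is Koszul: the residue field `A / A₊` has a linear graded free resolution over `A`. -/
def IsKoszul (𝒜 : ℕ → Submodule k A) : Prop :=
  ∃ F : GradedFreeResolution 𝒜 (quotientGrading 𝒜 (irrelevantIdeal 𝒜)), F.IsLinear

/-- The graded `A`-module `N` has (Castelnuovo-Mumford) regularity `r`: the number `r` is the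
largest `j` for which some graded Betti number `β_{i,i+j} = dim Torᵢ(N, A / A₊)_{i+j}` is nonzero.
The Betti numbers do not depend on the graded free resolution of `A / A₊` used to compute them. -/
def HasRegularity (𝒜 : ℕ → Submodule k A) {N : Type u} [AddCommGroup N] [Module k N]
    [Module A N] [IsScalarTower k A N] (𝒩 : ℕ → Submodule k N) (r : ℕ) : Prop :=
  ∃ F : GradedFreeResolution 𝒜 (quotientGrading 𝒜 (irrelevantIdeal 𝒜)),
    IsGreatest {j | ∃ i, F.torDim 𝒩 i (i + j) ≠ 0} r

/-- The graded algebra `A` has `h`-vector `h = (h₀, …, h_r)`: its Hilbert series is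
`(h₀ + h₁ t + ⋯ + h_r t ^ r) / (1 - t) ^ dim A`, with `h_r ≠ 0`. -/
def HasHVector (𝒜 : ℕ → Submodule k A) (h : List ℕ) : Prop :=
  (∃ r ∈ h.getLast?, r ≠ 0) ∧
  ∃ d : ℕ, ringKrullDim A = d ∧
    PowerSeries.mk (fun n => (Module.finrank k (𝒜 n) : ℤ)) * (1 - PowerSeries.X) ^ d =
      PowerSeries.mk (fun n => (h.getD n 0 : ℤ))

end Graded

/-- A Gorenstein ring: a Noetherian ring all of whose localizations at primes have finite
injective dimension as modules over themselves. -/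
def IsGorensteinRing (A : Type u) [CommRing A] : Prop :=
  IsNoetherianRing A ∧ ∀ (p : Ideal A) [p.IsPrime], ∃ n : ℕ,
    CategoryTheory.HasInjectiveDimensionLE
      (ModuleCat.of (Localization.AtPrime p) (Localization.AtPrime p)) n

/-- The ideal is generated by homogeneous polynomials of degree `2`. -/
def IsGeneratedByQuadrics {σ : Type} {k : Type u} [Field k] (I : Ideal (MvPolynomial σ k)) :
    Prop :=
  ∃ s : Set (MvPolynomial σ k), (∀ q ∈ s, q.IsHomogeneous 2) ∧ I = Ideal.span s

/-! ### Syzygies on a family of forms -/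

section Syzygies

variable {σ ι : Type} {k : Type u} [Field k] [Fintype ι]

/-- `v` is a syzygy on the family `g`. -/
def IsSyzygy (g v : ι → MvPolynomial σ k) : Prop :=
  ∑ a, v a * g a = 0

/-- The submodule generated by the linear syzygies (syzygies with coordinates linear forms)
and the Koszul syzygies `g_b e_a - g_a e_b` on the family `g`. -/
def linearKoszulSyzygies [DecidableEq ι] (g : ι → MvPolynomial σ k) :
    Submodule (MvPolynomial σ k) (ι → MvPolynomial σ k) :=
  Submodule.span (MvPolynomial σ k)
    ({v | IsSyzygy g v ∧ ∀ a, (v a).IsHomogeneous 1} ∪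
      {v | ∃ a b, v = Pi.single a (g b) - Pi.single b (g a)})

end Syzygies

/-! ### The example -/

section Example

variable (k : Type u) [Field k] (c : ℕ) [NeZero c]

/-- The inverse polynomial `F = ∑ y_i y_{i+1} y_{i+2}²`, indices modulo `c`. -/
def inversePoly : MvPolynomial (ZMod c) k :=
  ∑ i : ZMod c, X i * X (i + 1) * X (i + 2) ^ 2

/-- The absolute value `|i| = min {i, c - i}` on `ℤ/c`, with `i` represented in `{0, …, c-1}`. -/
def cycAbs (i : ZMod c) : ℕ := min i.val (c - i.val)

/-- The index set of the quadrics `q_i = x_i² - x_{i-1} x_{i-3}`, for `i` in `ℤ/c`, and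
`x_i x_j`, for `i < j` with `|i - j| ≥ 3`. -/
abbrev GenIndex : Type :=
  ZMod c ⊕ {p : ZMod c × ZMod c // p.1.val < p.2.val ∧ 3 ≤ cycAbs c (p.1 - p.2)}

instance : Fintype (GenIndex c) := by
  unfold GenIndex
  infer_instance

/-- The quadrics `x_i² - x_{i-1} x_{i-3}` and `x_i x_j`. -/
def gens : GenIndex c → MvPolynomial (ZMod c) k
  | Sum.inl i => X i ^ 2 - X (i - 1) * X (i - 3)
  | Sum.inr p => X p.1.1 * X p.1.2

/-- The vector with coordinate `x_{i-1} x_{i-2}` at `q_i` and `0` at the monomials. -/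
def syzU : GenIndex c → MvPolynomial (ZMod c) k
  | Sum.inl i => X (i - 1) * X (i - 2)
  | Sum.inr _ => 0

/-- The standard grading of `k[x_0, …, x_{c-1}]`. -/
abbrev polyGrading (n : ℕ) : Submodule k (MvPolynomial (ZMod c) k) :=
  homogeneousSubmodule (ZMod c) k n

/-- The ideal `I_F`. -/
abbrev idealF : Ideal (MvPolynomial (ZMod c) k) := annIdeal (inversePoly k c)

/-- The induced grading of `R = S / I_F`. -/
abbrev gradingR : ℕ → Submodule k (MvPolynomial (ZMod c) k ⧸ idealF k c) :=
  quotientGrading (polyGrading k c) (idealF k c)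

end Example

end QuadGor

end

/-! Everything rests on the functional `frob`, p ↦ (p·F)(0). Contraction is adjoint to
multiplication, so p annihilates F exactly when `frob` kills all multiples of p (`mem_idealF_iff`);
thus `frob` descends to R and induces a nondegenerate pairing there.

The explicit quadrics annihilate F. Modulo them, every form of degree n reduces to a combination of
normal forms, of which there are 1, c, 2c, c, 1 in degrees 0 to 4 and none beyond
(`SatisfiesRelations.aeval_mem_of_isHomogeneous`). Explicit elements of complementary degree are
dual to the normal forms under the pairing (`frob_normalForm_mul_dualForm`). Together these bounds
show that the quadrics generate I_F (`idealF_eq_genIdeal`) and give the h-vector. The nondegenerate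
functional makes the finite-dimensional local algebra R self-injective, hence Gorenstein. The cubes
of the variables lie in I_F, whence the height. Regularity is read off the Koszul resolution of the
residue field over S: R vanishes above degree 4, and the socle tensored with the top exterior power
survives in Tor.

For the syzygy u, the test is `avoidSubmodule`: the coordinate at q_j must have zero coefficient at
every divisor of x_{j-1}x_{j-2}. For any syzygy the coefficients at 1, x_{j-1} and x_{j-2} already
vanish, because a suitable monomial in the relation has a single contribution. Hence linear syzygies
and variables times arbitrary syzygies pass the test. Koszul syzygies pass too, since no quadric
involves x_{j-1}x_{j-2}, while u fails.

Failure of Koszulness transports this obstruction to R. The maps `varMap` and `relMap` begin a free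
resolution of the residue field over R. A cycle in the kernel of `relMap`, lifted to S, yields a
syzygy on the quadrics (`isSyzygy_of_lift`), and `liftable` collects the cycles for which some lift
passes the test. It contains the linear cycles and R₊ times all cycles. If a linear resolution
existed, comparison with it (`exists_sub_mem_smul_ker`) would put every cycle with entries in R₊
into `liftable`. But u extends to such a cycle, `cycleU`, and changing the lift alters the
associated syzygy only by elements that pass the test, so `cycleU` is not liftable. -/

namespace QuadGor

/-! ### The apolarity functional and the quadrics in the annihilator of F. -/

section Frobenius

variable (k : Type u) [Field k] (c : ℕ)

/-- The exponent of the monomial `y_l y_{l+1} y_{l+2}²` of `F`. -/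
noncomputable def topExp (l : ZMod c) : ZMod c →₀ ℕ :=
  Finsupp.single l 1 + Finsupp.single (l + 1) 1 + Finsupp.single (l + 2) 2

variable [NeZero c]

/-- The functional `p ↦ (p · F)(0)`. -/
noncomputable def frob : MvPolynomial (ZMod c) k →ₗ[k] k :=
  ∑ l : ZMod c, lcoeff k (topExp c l)

variable {k c}

theorem frob_apply (p : MvPolynomial (ZMod c) k) : frob k c p = ∑ l, coeff (topExp c l) p := by
  simp [frob, lcoeff]

theorem inversePoly_eq : inversePoly k c = ∑ l, monomial (topExp c l) 1 := by
  refine Finset.sum_congr rfl fun l _ => ?_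
  simp [topExp, X, monomial_mul, monomial_pow]

/-- Contraction is the transpose of multiplication; this turns annihilation of F into orthogonality
for `frob`. -/
theorem coeff_contraction_monomial {σ : Type} (μ β : σ →₀ ℕ) (p : MvPolynomial σ k) :
    coeff β (contraction p (monomial μ 1)) = coeff μ (monomial β 1 * p) := by
  classical
  induction p using MvPolynomial.induction_on' with
  | monomial α a =>
    rw [contraction_monomial, monomial_mul, coeff_monomial]
    by_cases h : α ≤ μ
    · simp only [if_pos h, coeff_monomial, tsub_eq_iff_eq_add_of_le h, mul_one, one_mul,
        eq_comm]
    · rw [if_neg h, if_neg, coeff_zero]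
      exact fun e => h (e ▸ le_add_self)
  | add p q hp hq =>
    rw [map_add, LinearMap.add_apply, coeff_add, hp, hq, mul_add, coeff_add]

theorem mem_idealF_iff {p : MvPolynomial (ZMod c) k} :
    p ∈ idealF k c ↔ ∀ q, frob k c (q * p) = 0 := by
  have h (β) : coeff β (contraction p (inversePoly k c)) = frob k c (monomial β 1 * p) := by
    rw [inversePoly_eq, map_sum, coeff_sum, frob_apply]
    simp only [coeff_contraction_monomial]
  constructor
  · intro hp q
    have hp' : contraction p (inversePoly k c) = 0 := hp
    induction q using MvPolynomial.induction_on' with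
    | monomial β a =>
      have := h β
      rw [hp', coeff_zero] at this
      rw [show monomial β a = a • monomial β (1 : k) by simp [smul_monomial], smul_mul_assoc,
        map_smul, ← this, smul_zero]
    | add q r hq hr => rw [add_mul, map_add, hq, hr, add_zero]
  · intro hp
    show contraction p (inversePoly k c) = 0
    ext β
    rw [h, hp, coeff_zero]

omit [NeZero c] in
theorem natCast_ne_zero_of_lt (hc : 7 ≤ c) {n : ℕ} (h0 : 0 < n) (h7 : n < 7) :
    (n : ZMod c) ≠ 0 := by
  rw [Ne, ZMod.natCast_eq_zero_iff]
  exact fun h => by have := Nat.le_of_dvd h0 h; omega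

-- The form in which the bound on c is mostly used: indices differing by 1 to 6 stay distinct. The
-- offset 6 is needed for x_i and x_{i+4} to be far apart.
omit [NeZero c] in
theorem add_small_ne (hc : 7 ≤ c) (l : ZMod c) : l + 1 ≠ l ∧ l + 2 ≠ l ∧ l + 3 ≠ l ∧
    l + 4 ≠ l ∧ l + 5 ≠ l ∧ l + 6 ≠ l := by
  have h (n : ℕ) (h0 : 0 < n) (h7 : n < 7) := natCast_ne_zero_of_lt hc h0 h7
  have h1 := h 1
  have h2 := h 2
  have h3 := h 3
  have h4 := h 4
  have h5 := h 5
  have h6 := h 6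
  simp at h1 h2 h3 h4 h5 h6
  simp [h1, h2, h3, h4, h5, h6]

/-- `3 ≤ |d|` means that `d` is none of `0, ±1, ±2`. -/
theorem three_le_cycAbs_iff (hc : 7 ≤ c) (d : ZMod c) :
    3 ≤ cycAbs c d ↔ d ≠ 0 ∧ d ≠ 1 ∧ d ≠ 2 ∧ d ≠ -1 ∧ d ≠ -2 := by
  have hd := ZMod.val_lt d
  have hv (n : ℕ) (hn : n < c) : d = n ↔ d.val = n := by
    constructor
    · rintro rfl; exact ZMod.val_cast_of_lt hn
    · intro h; rw [← h, ZMod.natCast_zmod_val]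
  have e1 : (-1 : ZMod c) = ((c - 1 : ℕ) : ZMod c) := by
    rw [Nat.cast_sub (by omega)]; simp
  have e2 : (-2 : ZMod c) = ((c - 2 : ℕ) : ZMod c) := by
    rw [Nat.cast_sub (by omega)]; simp
  have h0 := hv 0 (by omega)
  have h1 := hv 1 (by omega)
  have h2 := hv 2 (by omega)
  have h3 := hv (c - 1) (by omega)
  have h4 := hv (c - 2) (by omega)
  rw [← e1] at h3
  rw [← e2] at h4
  push_cast at h0 h1 h2
  simp only [Ne, h0, h1, h2, h3, h4, cycAbs]
  omega

omit [NeZero c] in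
theorem topExp_apply (l x : ZMod c) : topExp c l x =
    (if l = x then 1 else 0) + (if l + 1 = x then 1 else 0) + (if l + 2 = x then 2 else 0) := by
  simp [topExp, Finsupp.single_apply]

-- A monomial of F has exactly one squared variable, and the position of the square determines the
-- monomial.
omit [NeZero c] in
theorem sq_exp_eq_topExp_iff (hc : 7 ≤ c) (a b d l : ZMod c) :
    Finsupp.single a 1 + Finsupp.single a 1 + Finsupp.single b 1 + Finsupp.single d 1 = topExp c l ↔
      l = a - 2 ∧ (b = a - 1 ∧ d = a - 2 ∨ b = a - 2 ∧ d = a - 1) := by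
  obtain ⟨h1, h2, h3, h4, h5, h6⟩ := add_small_ne hc l
  constructor
  · intro h
    have e0 := DFunLike.congr_fun h l
    have e1 := DFunLike.congr_fun h (l + 1)
    have e2 := DFunLike.congr_fun h (l + 2)
    simp only [topExp_apply, Finsupp.add_apply, Finsupp.single_apply] at e0 e1 e2
    grind
  · rintro ⟨hl, h⟩
    ext x
    simp only [topExp_apply, Finsupp.add_apply, Finsupp.single_apply]
    grind

-- Every monomial of F contains a square, so a squarefree one never matches.
omit [NeZero c] in
theorem exp_ne_topExp {a b d e : ZMod c} (hab : a ≠ b) (had : a ≠ d) (hae : a ≠ e)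
    (hbd : b ≠ d) (hbe : b ≠ e) (hde : d ≠ e) (l : ZMod c) :
    Finsupp.single a 1 + Finsupp.single b 1 + Finsupp.single d 1 + Finsupp.single e 1 ≠
      topExp c l := by
  intro h
  have e2 := DFunLike.congr_fun h (l + 2)
  simp only [topExp_apply, Finsupp.add_apply, Finsupp.single_apply] at e2
  grind

omit [NeZero c] in
theorem X_mul_four (a b d e : ZMod c) : (X a * X b * X d * X e : MvPolynomial (ZMod c) k) =
    monomial (Finsupp.single a 1 + Finsupp.single b 1 + Finsupp.single d 1 + Finsupp.single e 1)
      1 := by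
  simp [X, monomial_mul]

theorem frob_sq (hc : 7 ≤ c) (a b d : ZMod c) : frob k c (X a * X a * X b * X d) =
    if b = a - 1 ∧ d = a - 2 ∨ b = a - 2 ∧ d = a - 1 then 1 else 0 := by
  rw [frob_apply, X_mul_four]
  simp only [coeff_monomial, sq_exp_eq_topExp_iff hc, ite_and]
  rw [Finset.sum_ite_eq' Finset.univ]
  simp

theorem frob_of_distinct {a b d e : ZMod c} (hab : a ≠ b) (had : a ≠ d) (hae : a ≠ e)
    (hbd : b ≠ d) (hbe : b ≠ e) (hde : d ≠ e) : frob k c (X a * X b * X d * X e) = 0 := by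
  rw [frob_apply, X_mul_four]
  simp [coeff_monomial, exp_ne_topExp hab had hae hbd hbe hde]

theorem frob_of_isHomogeneous {p : MvPolynomial (ZMod c) k} {n : ℕ} (hp : p.IsHomogeneous n)
    (hn : n ≠ 4) : frob k c p = 0 := by
  rw [frob_apply]
  refine Finset.sum_eq_zero fun l _ => hp.coeff_eq_zero ?_
  simpa [topExp, Finsupp.degree_single] using hn.symm

/-- The variables of each monomial of F lie in a window of three consecutive indices. -/
theorem X_mul_X_mem_idealF (hc : 7 ≤ c) {i j : ZMod c} (h : 3 ≤ cycAbs c (i - j)) :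
    X i * X j ∈ idealF k c := by
  rw [three_le_cycAbs_iff hc] at h
  rw [mem_idealF_iff]
  intro q
  induction q using MvPolynomial.induction_on' with
  | monomial β a =>
    rw [frob_apply]
    refine Finset.sum_eq_zero fun l _ => ?_
    rw [X, X, monomial_mul, monomial_mul, coeff_monomial, if_neg]
    intro e
    have e1 := DFunLike.congr_fun e i
    have e2 := DFunLike.congr_fun e j
    simp only [topExp_apply, Finsupp.add_apply, Finsupp.single_apply] at e1 e2
    obtain ⟨h1, h2, h3, h4, h5, h6⟩ := add_small_ne hc l
    grind
  | add q r hq hr => rw [add_mul, map_add, hq, hr, add_zero]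

/-- Both terms contract F to y_{i-1}y_{i-2}: the square meets only the summand starting at i-2, the
mixed product only the one starting at i-3. -/
theorem quadric_mem_idealF (hc : 7 ≤ c) (i : ZMod c) :
    X i ^ 2 - X (i - 1) * X (i - 3) ∈ idealF k c := by
  rw [mem_idealF_iff]
  intro q
  induction q using MvPolynomial.induction_on' with
  | monomial β a =>
    rw [mul_sub, map_sub, sub_eq_zero, frob_apply, frob_apply, sq]
    obtain ⟨n1, n2, n3, n4, n5, n6⟩ := add_small_ne hc i
    have t1 : topExp c (i - 2) = Finsupp.single (i - 1) 1 + Finsupp.single (i - 2) 1 +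
        (Finsupp.single i 1 + Finsupp.single i 1) := by
      rw [topExp, show i - 2 + 1 = i - 1 by ring, show i - 2 + 2 = i by ring,
        ← Finsupp.single_add, add_comm (Finsupp.single (i - 2) 1)]
    have t2 : topExp c (i - 3) = Finsupp.single (i - 1) 1 + Finsupp.single (i - 2) 1 +
        (Finsupp.single (i - 1) 1 + Finsupp.single (i - 3) 1) := by
      rw [topExp, show i - 3 + 1 = i - 2 by ring, show i - 3 + 2 = i - 1 by ring,
        show Finsupp.single (i - 1) 2 = Finsupp.single (i - 1) 1 + Finsupp.single (i - 1) 1 from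
          Finsupp.single_add _ 1 1]
      abel
    have h1 (l : ZMod c) : β + (Finsupp.single i 1 + Finsupp.single i 1) = topExp c l ↔
        l = i - 2 ∧ β = Finsupp.single (i - 1) 1 + Finsupp.single (i - 2) 1 := by
      constructor
      · intro e
        have e1 := DFunLike.congr_fun e i
        simp only [topExp_apply, Finsupp.add_apply, Finsupp.single_apply] at e1
        obtain rfl : l = i - 2 := by grind
        exact ⟨rfl, add_right_cancel (e.trans t1)⟩
      · rintro ⟨rfl, rfl⟩
        exact t1.symm
    have h2 (l : ZMod c) : β + (Finsupp.single (i - 1) 1 + Finsupp.single (i - 3) 1) =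
        topExp c l ↔ l = i - 3 ∧ β = Finsupp.single (i - 1) 1 + Finsupp.single (i - 2) 1 := by
      constructor
      · intro e
        have e1 := DFunLike.congr_fun e (i - 1)
        have e2 := DFunLike.congr_fun e (i - 3)
        simp only [topExp_apply, Finsupp.add_apply, Finsupp.single_apply] at e1 e2
        obtain rfl : l = i - 3 := by grind
        exact ⟨rfl, add_right_cancel (e.trans t2)⟩
      · rintro ⟨rfl, rfl⟩
        exact t2.symm
    simp only [X, monomial_mul, coeff_monomial, h1, h2, ite_and, mul_one]
    rw [Finset.sum_ite_eq' Finset.univ, Finset.sum_ite_eq' Finset.univ]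
    simp
  | add q r hq hr => rw [add_mul, map_add, hq, hr, add_zero]

end Frobenius

/-! ### Reduction to normal forms in a ring satisfying the relations. -/

section NormalForms

/-- The index set of the normal forms of degree `n`. -/
def NormalIndex (c : ℕ) : ℕ → Type
  | 0 => Unit
  | 1 => ZMod c
  | 2 => ZMod c ⊕ ZMod c
  | 3 => ZMod c
  | 4 => Unit
  | _ => Empty

instance (c : ℕ) [NeZero c] : (n : ℕ) → Fintype (NormalIndex c n)
  | 0 => inferInstanceAs (Fintype Unit)
  | 1 => inferInstanceAs (Fintype (ZMod c))
  | 2 => inferInstanceAs (Fintype (ZMod c ⊕ ZMod c))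
  | 3 => inferInstanceAs (Fintype (ZMod c))
  | 4 => inferInstanceAs (Fintype Unit)
  | _ + 5 => inferInstanceAs (Fintype Empty)

variable {c : ℕ} {Q : Type*} [CommRing Q]

/-- The product `x_i x_{i+1} x_{i+2}`. -/
def threeForm (x : ZMod c → Q) (i : ZMod c) : Q := x i * x (i + 1) * x (i + 2)

/-- The normal forms `1`, `x_i`, `x_i²`, `x_i x_{i+1}`, `x_i x_{i+1} x_{i+2}`,
`x_0 x_1 x_2²`. -/
def normalForm (x : ZMod c → Q) : (n : ℕ) → NormalIndex c n → Q
  | 0, _ => 1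
  | 1, i => x i
  | 2, Sum.inl i => x i * x i
  | 2, Sum.inr i => x i * x (i + 1)
  | 3, i => threeForm x i
  | 4, _ => x 0 * x 1 * x 2 * x 2
  | _ + 5, b => b.elim

/-- The defining relations of `R` for a family of elements of a ring. -/
structure SatisfiesRelations (x : ZMod c → Q) : Prop where
  quadric : ∀ i, x i * x i = x (i - 1) * x (i - 3)
  far : ∀ i j, i ≠ j → i ≠ j + 1 → i ≠ j + 2 → j ≠ i + 1 → j ≠ i + 2 → x i * x j = 0

namespace SatisfiesRelations

variable {x : ZMod c → Q} (h : SatisfiesRelations x) (hc : 7 ≤ c) [NeZero c]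
include h hc

omit [NeZero c] in
theorem mul_add_three (i : ZMod c) : x i * x (i + 3) = 0 := by
  obtain ⟨h1, h2, h3, h4, h5, h6⟩ := add_small_ne hc i
  apply h.far
  · exact fun e => h3 e.symm
  · exact fun e => h4 (by linear_combination -e)
  · exact fun e => h5 (by linear_combination -e)
  · exact fun e => h2 (by linear_combination e)
  · exact fun e => h1 (by linear_combination e)

-- Going round the other way, the distance is c - 4, which is at least 3 because c ≥ 7.
omit [NeZero c] in
theorem mul_add_four (i : ZMod c) : x i * x (i + 4) = 0 := by
  obtain ⟨h1, h2, h3, h4, h5, h6⟩ := add_small_ne hc i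
  apply h.far
  · exact fun e => h4 e.symm
  · exact fun e => h5 (by linear_combination -e)
  · exact fun e => h6 (by linear_combination -e)
  · exact fun e => h3 (by linear_combination e)
  · exact fun e => h2 (by linear_combination e)

omit [NeZero c] in
theorem mul_eq_zero_of_three {i j : ZMod c} (e : j = i + 3) : x i * x j = 0 :=
  e ▸ h.mul_add_three hc i

omit [NeZero c] in
theorem mul_eq_zero_of_four {i j : ZMod c} (e : j = i + 4) : x i * x j = 0 :=
  e ▸ h.mul_add_four hc i

-- Replacing the square by x_{i-1}x_{i-3} creates a pair of variables at distance at least 3; the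
-- next two lemmas use the same device.
omit [NeZero c] in
theorem sq_mul_self (i : ZMod c) : x i * x i * x i = 0 := by
  have e := h.mul_eq_zero_of_three hc (i := i - 3) (j := i) (by ring)
  linear_combination x i * h.quadric i + x (i - 1) * e

omit [NeZero c] in
theorem sq_mul_add_one (i : ZMod c) : x i * x i * x (i + 1) = 0 := by
  have e := h.mul_eq_zero_of_four hc (i := i - 3) (j := i + 1) (by ring)
  linear_combination x (i + 1) * h.quadric i + x (i - 1) * e

omit [NeZero c] in
theorem sq_mul_add_two (i : ZMod c) : x i * x i * x (i + 2) = 0 := by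
  have e := h.mul_eq_zero_of_three hc (i := i - 1) (j := i + 2) (by ring)
  linear_combination x (i + 2) * h.quadric i + x (i - 3) * e

-- The quadric relation is used twice: x_i²x_{i-1} = x_{i-1}²x_{i-3} = x_{i-2}x_{i-4}x_{i-3}.
omit hc [NeZero c] in
theorem sq_mul_sub_one (i : ZMod c) :
    x i * x i * x (i - 1) = x (i - 4) * x (i - 4 + 1) * x (i - 4 + 2) := by
  have e := h.quadric (i - 1)
  rw [show i - 1 - 1 = i - 2 by ring, show i - 1 - 3 = i - 4 by ring] at e
  rw [show i - 4 + 1 = i - 3 by ring, show i - 4 + 2 = i - 2 by ring]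
  linear_combination x (i - 1) * h.quadric i + x (i - 3) * e

omit hc [NeZero c] in
theorem sq_mul_sub_two (i : ZMod c) :
    x i * x i * x (i - 2) = x (i - 3) * x (i - 3 + 1) * x (i - 3 + 2) := by
  rw [show i - 3 + 1 = i - 2 by ring, show i - 3 + 2 = i - 1 by ring]
  linear_combination x (i - 2) * h.quadric i

-- The relation x_{i+3}² = x_{i+2}x_i identifies neighbouring monomials of F. Going round the cycle
-- identifies all of them, which makes degree 4 at most one-dimensional.
omit hc [NeZero c] in
theorem top_succ (i : ZMod c) : x (i + 1) * x (i + 1 + 1) * x (i + 1 + 2) * x (i + 1 + 2) =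
    x i * x (i + 1) * x (i + 2) * x (i + 2) := by
  have e := h.quadric (i + 3)
  rw [show i + 3 - 1 = i + 2 by ring, show i + 3 - 3 = i by ring] at e
  rw [show i + 1 + 1 = i + 2 by ring, show i + 1 + 2 = i + 3 by ring]
  linear_combination x (i + 1) * x (i + 2) * e

omit hc in
theorem top_eq (i : ZMod c) :
    x i * x (i + 1) * x (i + 2) * x (i + 2) = x 0 * x 1 * x 2 * x 2 := by
  have key (n : ℕ) : x (n : ZMod c) * x (n + 1) * x (n + 2) * x (n + 2) =
      x 0 * x 1 * x 2 * x 2 := by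
    induction n with
    | zero => simp
    | succ n ih => rw [Nat.cast_succ, h.top_succ, ih]
  simpa using key i.val

theorem mul_top (j : ZMod c) : x j * (x 0 * x 1 * x 2 * x 2) = 0 := by
  have e := h.mul_add_three hc j
  -- The top form may start at any index; starting it at j + 3 exposes a factor that x_j kills.
  rw [← h.top_eq (j + 3)]
  linear_combination x (j + 3 + 1) * x (j + 3 + 2) * x (j + 3 + 2) * e

omit [NeZero c] in
theorem mul_normalForm_two (j i : ZMod c) :
    x j * (x i * x i) = 0 ∨ ∃ l, x j * (x i * x i) = x l * x (l + 1) * x (l + 2) := by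
  by_cases h0 : j = i
  · subst h0; left; linear_combination h.sq_mul_self hc j
  by_cases h1 : j = i + 1
  · subst h1; left; linear_combination h.sq_mul_add_one hc i
  by_cases h2 : j = i + 2
  · subst h2; left; linear_combination h.sq_mul_add_two hc i
  by_cases h3 : j = i - 1
  · subst h3; right; exact ⟨i - 4, by linear_combination h.sq_mul_sub_one i⟩
  by_cases h4 : j = i - 2
  · subst h4; right; exact ⟨i - 3, by linear_combination h.sq_mul_sub_two i⟩
  left
  have e : x j * x i = 0 := by apply h.far <;> grind
  linear_combination x i * e

omit [NeZero c] in
theorem mul_normalForm_two' (j i : ZMod c) :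
    x j * (x i * x (i + 1)) = 0 ∨
      ∃ l, x j * (x i * x (i + 1)) = x l * x (l + 1) * x (l + 2) := by
  obtain ⟨n1, n2, n3, n4, n5, n6⟩ := add_small_ne hc i
  by_cases h0 : j = i
  · subst h0; left; linear_combination h.sq_mul_add_one hc j
  by_cases h1 : j = i + 1
  · subst h1; right
    refine ⟨i - 3, ?_⟩
    have e := h.sq_mul_sub_one (i + 1)
    rw [show i + 1 - 1 = i by ring, show i + 1 - 4 = i - 3 by ring] at e
    linear_combination e
  by_cases h2 : j = i + 2
  · subst h2; right; exact ⟨i, by ring⟩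
  by_cases h3 : j = i - 1
  · subst h3; right
    refine ⟨i - 1, ?_⟩
    rw [show i - 1 + 1 = i by ring, show i - 1 + 2 = i + 1 by ring]
    ring
  left
  by_cases h4 : j = i - 2
  · have e : x j * x (i + 1) = 0 := h.mul_eq_zero_of_three hc (by rw [h4]; ring)
    linear_combination x i * e
  have e : x j * x i = 0 := by apply h.far <;> grind
  linear_combination x (i + 1) * e

theorem mul_normalForm_three (j i : ZMod c) :
    x j * (x i * x (i + 1) * x (i + 2)) = 0 ∨
      x j * (x i * x (i + 1) * x (i + 2)) = x 0 * x 1 * x 2 * x 2 := by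
  obtain ⟨n1, n2, n3, n4, n5, n6⟩ := add_small_ne hc i
  by_cases h0 : j = i
  · subst h0; left; linear_combination x (j + 2) * h.sq_mul_add_one hc j
  by_cases h1 : j = i + 1
  · subst h1; left
    have e := h.sq_mul_add_one hc (i + 1)
    rw [show i + 1 + 1 = i + 2 by ring] at e
    linear_combination x i * e
  by_cases h2 : j = i + 2
  · subst h2; right; rw [← h.top_eq i]; ring
  left
  by_cases h3 : j = i - 1
  · have e : x j * x (i + 2) = 0 := h.mul_eq_zero_of_three hc (by rw [h3]; ring)
    linear_combination x i * x (i + 1) * e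
  by_cases h4 : j = i - 2
  · have e : x j * x (i + 1) = 0 := h.mul_eq_zero_of_three hc (by rw [h4]; ring)
    linear_combination x i * x (i + 2) * e
  have e : x j * x i = 0 := by apply h.far <;> grind
  linear_combination x (i + 1) * x (i + 2) * e

variable {k : Type*} [Field k] [Algebra k Q]

variable (k) in
omit hc [NeZero c] in
theorem mul_mem_span_two (j i : ZMod c) :
    x j * x i ∈ Submodule.span k (Set.range (normalForm x 2)) := by
  have sq (l : ZMod c) : x l * x l ∈ Submodule.span k (Set.range (normalForm x 2)) :=
    Submodule.subset_span ⟨Sum.inl l, rfl⟩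
  by_cases h0 : j = i
  · rw [h0]; exact sq i
  by_cases h1 : j = i + 1
  · rw [h1]; exact Submodule.subset_span ⟨Sum.inr i, by simp [normalForm, mul_comm]⟩
  by_cases h2 : i = j + 1
  · rw [h2]; exact Submodule.subset_span ⟨Sum.inr j, by simp [normalForm]⟩
  by_cases h3 : j = i + 2
  · have e := h.quadric (i + 3)
    rw [show i + 3 - 1 = i + 2 by ring, show i + 3 - 3 = i by ring] at e
    rw [h3, ← e]; exact sq _
  by_cases h4 : i = j + 2
  · have e := h.quadric (j + 3)
    rw [show j + 3 - 1 = j + 2 by ring, show j + 3 - 3 = j by ring] at e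
    rw [h4, mul_comm, ← e]; exact sq _
  · rw [h.far j i h0 h1 h3 h2 h4]; exact zero_mem _

variable (k) in
theorem mul_normalForm_mem (j : ZMod c) (n : ℕ) (b : NormalIndex c n) :
    x j * normalForm x n b ∈ Submodule.span k (Set.range (normalForm x (n + 1))) := by
  match n, b with
  | 0, b => exact Submodule.subset_span ⟨j, by simp [normalForm]⟩
  | 1, i =>
    exact h.mul_mem_span_two k j i
  | 2, Sum.inl i =>
    simp only [normalForm]
    obtain e | ⟨l, e⟩ := h.mul_normalForm_two hc j i
    · rw [e]; exact zero_mem _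
    · rw [e]; exact Submodule.subset_span ⟨l, rfl⟩
  | 2, Sum.inr i =>
    simp only [normalForm]
    obtain e | ⟨l, e⟩ := h.mul_normalForm_two' hc j i
    · rw [e]; exact zero_mem _
    · rw [e]; exact Submodule.subset_span ⟨l, rfl⟩
  | 3, i =>
    simp only [normalForm, threeForm]
    obtain e | e := h.mul_normalForm_three hc j i
    · rw [e]; exact zero_mem _
    · rw [e]; exact Submodule.subset_span ⟨(), rfl⟩
  | 4, b =>
    simp only [normalForm]
    rw [h.mul_top hc]; exact zero_mem _
  | n + 5, b => exact b.elim

theorem mul_mem_span (j : ZMod c) (n : ℕ) {q : Q}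
    (hq : q ∈ Submodule.span k (Set.range (normalForm x n))) :
    x j * q ∈ Submodule.span k (Set.range (normalForm x (n + 1))) := by
  induction hq using Submodule.span_induction with
  | mem q hq =>
    obtain ⟨b, rfl⟩ := hq
    exact h.mul_normalForm_mem hc k j n b
  | zero => rw [mul_zero]; exact zero_mem _
  | add p q _ _ hp hq => rw [mul_add]; exact add_mem hp hq
  | smul a q _ hq => rw [mul_smul_comm]; exact Submodule.smul_mem _ _ hq

/-- Variables are peeled off one at a time, since multiplication by a variable carries the span of
the normal forms of one degree into that of the next. -/
theorem aeval_monomial_mem (n : ℕ) (α : ZMod c →₀ ℕ) (hα : α.degree = n) (a : k) :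
    aeval x (monomial α a) ∈ Submodule.span k (Set.range (normalForm x n)) := by
  induction n generalizing α with
  | zero =>
    obtain rfl : α = 0 := (Finsupp.degree_eq_zero_iff α).mp hα
    have : aeval x (monomial 0 a) = a • (1 : Q) := by
      rw [← C_apply, ← algebraMap_eq, AlgHom.commutes, Algebra.algebraMap_eq_smul_one]
    rw [this]
    exact Submodule.smul_mem _ _ (Submodule.subset_span ⟨(), rfl⟩)
  | succ n ih =>
    obtain ⟨j, hj⟩ : ∃ j, α j ≠ 0 := by
      by_contra! h0
      obtain rfl : α = 0 := by ext; simp [h0]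
      simp at hα
    have hle : Finsupp.single j 1 ≤ α := by
      simpa using Nat.one_le_iff_ne_zero.mpr hj
    obtain ⟨β, rfl⟩ := exists_add_of_le hle
    rw [map_add, Finsupp.degree_single] at hα
    have e : (monomial (Finsupp.single j 1 + β) a : MvPolynomial (ZMod c) k) =
        X j * monomial β a := by
      rw [X, monomial_mul, one_mul]
    rw [e, map_mul, aeval_X]
    exact h.mul_mem_span hc j n (ih β (by omega))

theorem aeval_mem_of_isHomogeneous {n : ℕ} {p : MvPolynomial (ZMod c) k}
    (hp : p.IsHomogeneous n) :
    aeval x p ∈ Submodule.span k (Set.range (normalForm x n)) := by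
  rw [p.as_sum, map_sum]
  refine sum_mem fun α hα => h.aeval_monomial_mem hc n α ?_ _
  by_contra hne
  exact (mem_support_iff.mp hα) (hp.coeff_eq_zero hne)

end SatisfiesRelations

end NormalForms

/-! ### Dual forms, equality of I_F with the ideal of the quadrics, and the Hilbert function. -/

section Basis

variable {k : Type u} [Field k] {c : ℕ} [NeZero c]

theorem frob_one_three (hc : 7 ≤ c) (i j : ZMod c) :
    frob k c (X i * (X (j - 2) * X (j - 1) * X j)) = if i = j then 1 else 0 := by
  obtain ⟨n1, n2, n3, n4, n5, n6⟩ := add_small_ne hc j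
  by_cases h0 : i = j
  · rw [if_pos h0, h0, show (X j * (X (j - 2) * X (j - 1) * X j) : MvPolynomial (ZMod c) k) =
      X j * X j * X (j - 1) * X (j - 2) by ring, frob_sq hc, if_pos (Or.inl ⟨rfl, rfl⟩)]
  rw [if_neg h0]
  by_cases h1 : i = j - 1
  · rw [h1, show (X (j - 1) * (X (j - 2) * X (j - 1) * X j) : MvPolynomial (ZMod c) k) =
      X (j - 1) * X (j - 1) * X (j - 2) * X j by ring, frob_sq hc, if_neg]
    rintro (⟨-, e⟩ | ⟨-, e⟩)
    · exact n3 (by linear_combination e)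
    · exact n2 (by linear_combination e)
  by_cases h2 : i = j - 2
  · rw [h2, show (X (j - 2) * (X (j - 2) * X (j - 1) * X j) : MvPolynomial (ZMod c) k) =
      X (j - 2) * X (j - 2) * X (j - 1) * X j by ring, frob_sq hc, if_neg]
    rintro (⟨-, e⟩ | ⟨-, e⟩)
    · exact n4 (by linear_combination e)
    · exact n3 (by linear_combination e)
  rw [← mul_assoc, ← mul_assoc, frob_of_distinct h2 h1 h0]
  · exact fun e => n1 (by linear_combination -e)
  · exact fun e => n2 (by linear_combination -e)
  · exact fun e => n1 (by linear_combination -e)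

theorem frob_sq_adj (hc : 7 ≤ c) (i j : ZMod c) :
    frob k c (X i * X i * (X (j - 1) * X (j - 2))) = if i = j then 1 else 0 := by
  rw [← mul_assoc, frob_sq hc]
  obtain ⟨n1, n2, n3, n4, n5, n6⟩ := add_small_ne hc j
  congr 1
  rw [eq_iff_iff]
  constructor
  · rintro (⟨e, -⟩ | ⟨e, e'⟩)
    · linear_combination -e
    · exact absurd (by linear_combination e - e') n2
  · rintro rfl
    exact Or.inl ⟨rfl, rfl⟩

theorem frob_sq_sq (hc : 7 ≤ c) (i j : ZMod c) : frob k c (X i * X i * (X j * X j)) = 0 := by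
  rw [← mul_assoc, frob_sq hc, if_neg]
  obtain ⟨n1, n2, n3, n4, n5, n6⟩ := add_small_ne hc j
  rintro (⟨e, e'⟩ | ⟨e, e'⟩)
  · exact n1 (by linear_combination e' - e)
  · exact n1 (by linear_combination e - e')

/-- If two adjacent pairs share one index, the square sits between its two neighbours, whereas in F
the squared variable comes at the end of the window. Two equal pairs give two squares, and disjoint
pairs give none. -/
theorem frob_adj_adj (hc : 7 ≤ c) (i j : ZMod c) :
    frob k c (X i * X (i + 1) * (X (j - 1) * X (j - 2))) = 0 := by
  obtain ⟨n1, n2, n3, n4, n5, n6⟩ := add_small_ne hc j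
  by_cases h1 : i = j - 1
  · rw [h1, show (X (j - 1) * X (j - 1 + 1) * (X (j - 1) * X (j - 2)) :
      MvPolynomial (ZMod c) k) = X (j - 1) * X (j - 1) * X (j - 1 + 1) * X (j - 2) by ring,
      frob_sq hc, if_neg]
    rintro (⟨e, -⟩ | ⟨e, -⟩)
    · exact n2 (by linear_combination e)
    · exact n3 (by linear_combination e)
  by_cases h2 : i = j - 2
  · rw [h2, show j - 2 + 1 = j - 1 by ring,
      show (X (j - 2) * X (j - 1) * (X (j - 1) * X (j - 2)) : MvPolynomial (ZMod c) k) =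
      X (j - 2) * X (j - 2) * (X (j - 1) * X (j - 1)) by ring, frob_sq_sq hc]
  by_cases h3 : i = j - 3
  · rw [h3, show j - 3 + 1 = j - 2 by ring,
      show (X (j - 3) * X (j - 2) * (X (j - 1) * X (j - 2)) : MvPolynomial (ZMod c) k) =
      X (j - 2) * X (j - 2) * X (j - 3) * X (j - 1) by ring, frob_sq hc, if_neg]
    rintro (⟨-, e⟩ | ⟨-, e⟩)
    · exact n3 (by linear_combination e)
    · exact n2 (by linear_combination e)
  rw [← mul_assoc, frob_of_distinct _ h1 h2]
  · exact fun e => h2 (by linear_combination e)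
  · exact fun e => h3 (by linear_combination e)
  · exact fun e => n1 (by linear_combination e)
  · exact fun e => n1 (by linear_combination -e)

theorem frob_adj_sq (hc : 7 ≤ c) (i j : ZMod c) :
    frob k c (X i * X (i + 1) * (X (j + 2) * X (j + 2))) = if i = j then 1 else 0 := by
  rw [show (X i * X (i + 1) * (X (j + 2) * X (j + 2)) : MvPolynomial (ZMod c) k) =
      X (j + 2) * X (j + 2) * X i * X (i + 1) by ring, frob_sq hc]
  obtain ⟨n1, n2, n3, n4, n5, n6⟩ := add_small_ne hc j
  congr 1
  rw [eq_iff_iff]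
  constructor
  · rintro (⟨e, e'⟩ | ⟨e, e'⟩)
    · exact absurd (by linear_combination e' - e) n2
    · linear_combination e
  · rintro rfl
    exact Or.inr ⟨by ring, by ring⟩

theorem frob_three_one (hc : 7 ≤ c) (i j : ZMod c) :
    frob k c (X i * X (i + 1) * X (i + 2) * X (j + 2)) = if i = j then 1 else 0 := by
  have e := frob_one_three (k := k) hc (j + 2) (i + 2)
  rw [show i + 2 - 2 = i by ring, show i + 2 - 1 = i + 1 by ring, mul_comm] at e
  rw [e]
  simp only [add_left_inj, eq_comm]

theorem frob_top (hc : 7 ≤ c) : frob k c (X 0 * X 1 * X 2 * X 2) = 1 := by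
  rw [show (X 0 * X 1 * X 2 * X 2 : MvPolynomial (ZMod c) k) = X 2 * X 2 * X 0 * X 1 by ring,
    frob_sq hc, if_pos]
  exact Or.inr ⟨by ring, by ring⟩

variable (k) in
/-- The elements dual to the normal forms under the pairing `(p, q) ↦ frob (p q)`. -/
noncomputable def dualForm : (n : ℕ) → NormalIndex c n → MvPolynomial (ZMod c) k
  | 0, _ => X 0 * X 1 * X 2 * X 2
  | 1, i => dualThree i
  | 2, Sum.inl i => X (i - 1) * X (i - 2)
  | 2, Sum.inr i => X (i + 2) * X (i + 2)
  | 3, i => dualOne i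
  | 4, _ => 1
  | _ + 5, b => b.elim
where
  dualThree (i : ZMod c) : MvPolynomial (ZMod c) k := X (i - 2) * X (i - 1) * X i
  dualOne (i : ZMod c) : MvPolynomial (ZMod c) k := X (i + 2)

-- The Gram matrix is the identity. In degree 2 squares are dual to adjacent products and vice
-- versa, and the two cross blocks vanish.
open Classical in
theorem frob_normalForm_mul_dualForm (hc : 7 ≤ c) (n : ℕ) (a b : NormalIndex c n) :
    frob k c (normalForm X n a * dualForm k n b) = if a = b then 1 else 0 := by
  match n, a, b with
  | 0, (), () => simp [normalForm, dualForm, frob_top hc]; rfl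
  | 1, a, b => exact (frob_one_three hc a b).trans (by congr)
  | 2, Sum.inl a, Sum.inl b =>
    refine (frob_sq_adj hc a b).trans ?_
    exact if_congr Sum.inl_injective.eq_iff.symm rfl rfl
  | 2, Sum.inl a, Sum.inr b => simpa [normalForm, dualForm] using frob_sq_sq hc a (b + 2)
  | 2, Sum.inr a, Sum.inl b => simpa [normalForm, dualForm] using frob_adj_adj hc a b
  | 2, Sum.inr a, Sum.inr b =>
    refine (frob_adj_sq hc a b).trans ?_
    exact if_congr Sum.inr_injective.eq_iff.symm rfl rfl
  | 3, a, b => exact (frob_three_one hc a b).trans (by congr)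
  | 4, (), () => simp [normalForm, dualForm, frob_top hc]; rfl
  | n + 5, a, b => exact a.elim

omit [NeZero c] in
theorem isHomogeneous_normalForm (n : ℕ) (a : NormalIndex c n) :
    (normalForm (X : ZMod c → MvPolynomial (ZMod c) k) n a).IsHomogeneous n := by
  have h := isHomogeneous_X (σ := ZMod c) k
  match n, a with
  | 0, a => exact isHomogeneous_one _ _
  | 1, i => exact h i
  | 2, Sum.inl i => exact (h i).mul (h i)
  | 2, Sum.inr i => exact (h i).mul (h (i + 1))
  | 3, i => exact ((h _).mul (h _)).mul (h _)
  | 4, _ => exact (((h _).mul (h _)).mul (h _)).mul (h _)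
  | _ + 5, b => exact b.elim

omit [NeZero c] in
theorem isHomogeneous_dualForm (n : ℕ) (a : NormalIndex c n) :
    (dualForm k n a).IsHomogeneous (4 - n) := by
  have h := isHomogeneous_X (σ := ZMod c) k
  match n, a with
  | 0, a => exact (((h _).mul (h _)).mul (h _)).mul (h _)
  | 1, i => exact ((h _).mul (h _)).mul (h _)
  | 2, Sum.inl i => exact (h _).mul (h _)
  | 2, Sum.inr i => exact (h _).mul (h _)
  | 3, i => exact h _
  | 4, _ => exact isHomogeneous_one _ _
  | _ + 5, b => exact b.elim

variable (k c) in
/-- The ideal generated by the explicit quadrics. -/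
noncomputable abbrev genIdeal : Ideal (MvPolynomial (ZMod c) k) := Ideal.span (Set.range (gens k c))

theorem genIdeal_le_idealF (hc : 7 ≤ c) : genIdeal k c ≤ idealF k c := by
  rw [Ideal.span_le]
  rintro _ ⟨i | p, rfl⟩
  · exact quadric_mem_idealF hc i
  · exact X_mul_X_mem_idealF hc p.2.2

theorem X_mul_X_mem_genIdeal (hc : 7 ≤ c) {i j : ZMod c} (h0 : i ≠ j) (h1 : i ≠ j + 1)
    (h2 : i ≠ j + 2) (h3 : j ≠ i + 1) (h4 : j ≠ i + 2) : X i * X j ∈ genIdeal k c := by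
  have key (i j : ZMod c) (h0 : i ≠ j) (h1 : i ≠ j + 1)
    (h2 : i ≠ j + 2) (h3 : j ≠ i + 1) (h4 : j ≠ i + 2) (h : i.val < j.val) :
      X i * X j ∈ genIdeal k c := by
    refine Ideal.subset_span ⟨Sum.inr ⟨(i, j), h, ?_⟩, rfl⟩
    rw [three_le_cycAbs_iff hc]
    exact ⟨fun e => h0 (by linear_combination e), fun e => h1 (by linear_combination e),
      fun e => h2 (by linear_combination e), fun e => h3 (by linear_combination -e),
      fun e => h4 (by linear_combination -e)⟩
  rcases lt_trichotomy i.val j.val with h | h | h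
  · exact key i j h0 h1 h2 h3 h4 h
  · exact absurd (ZMod.val_injective c h) h0
  · rw [mul_comm]
    exact key j i h0.symm h3 h4 h1 h2 h

theorem satisfiesRelations_mk (hc : 7 ≤ c) {I : Ideal (MvPolynomial (ZMod c) k)}
    (hI : genIdeal k c ≤ I) : SatisfiesRelations fun i => Ideal.Quotient.mk I (X i) where
  quadric i := by
    rw [← map_mul, ← map_mul, Ideal.Quotient.eq, ← sq]
    exact hI (Ideal.subset_span ⟨Sum.inl i, rfl⟩)
  far i j h0 h1 h2 h3 h4 := by
    rw [← map_mul, Ideal.Quotient.eq_zero_iff_mem]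
    exact hI (X_mul_X_mem_genIdeal hc h0 h1 h2 h3 h4)

omit [NeZero c] in
theorem map_normalForm {Q Q' : Type*} [CommRing Q] [CommRing Q'] (f : Q →+* Q')
    (x : ZMod c → Q) (n : ℕ) (a : NormalIndex c n) :
    f (normalForm x n a) = normalForm (fun i => f (x i)) n a := by
  match n, a with
  | 0, a => simp [normalForm]
  | 1, i => simp [normalForm]
  | 2, Sum.inl i => simp [normalForm]
  | 2, Sum.inr i => simp [normalForm]
  | 3, i => simp [normalForm, threeForm]
  | 4, _ => simp [normalForm]
  | _ + 5, b => exact b.elim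

theorem mk_mem_span_normalForm (hc : 7 ≤ c) {I : Ideal (MvPolynomial (ZMod c) k)}
    (hI : genIdeal k c ≤ I) {n : ℕ} {p : MvPolynomial (ZMod c) k} (hp : p.IsHomogeneous n) :
    Ideal.Quotient.mk I p ∈
      Submodule.span k (Set.range (normalForm (fun i => Ideal.Quotient.mk I (X i)) n)) := by
  have h := (satisfiesRelations_mk hc hI).aeval_mem_of_isHomogeneous hc hp
  have e : aeval (fun i => Ideal.Quotient.mk I (X i)) = Ideal.Quotient.mkₐ k I := by
    ext i; simp
  rw [e] at h
  exact h

/-- A homogeneous polynomial is congruent to a combination of normal forms. -/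
theorem exists_sub_sum_mem_genIdeal (hc : 7 ≤ c) {n : ℕ} {p : MvPolynomial (ZMod c) k}
    (hp : p.IsHomogeneous n) :
    ∃ r : NormalIndex c n → k, p - ∑ a, r a • normalForm X n a ∈ genIdeal k c := by
  have h := mk_mem_span_normalForm hc le_rfl hp
  rw [Submodule.mem_span_range_iff_exists_fun] at h
  obtain ⟨r, hr⟩ := h
  refine ⟨r, ?_⟩
  rw [← Ideal.Quotient.eq, ← hr, map_sum]
  refine Finset.sum_congr rfl fun a _ => ?_
  rw [← map_normalForm]
  exact (map_smul (Ideal.Quotient.mkₐ k _) _ _).symm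

/-- The quadrics annihilate F, so reduction to normal forms does not change the pairings, and these
pairings are the coefficients of the reduction. -/
theorem mem_genIdeal_of_isHomogeneous (hc : 7 ≤ c) {n : ℕ} {p : MvPolynomial (ZMod c) k}
    (hp : p.IsHomogeneous n) (h : ∀ b : NormalIndex c n, frob k c (p * dualForm k n b) = 0) :
    p ∈ genIdeal k c := by
  classical
  obtain ⟨r, hr⟩ := exists_sub_sum_mem_genIdeal hc hp
  have hr0 : r = 0 := by
    ext b
    have h1 := mem_idealF_iff.mp (genIdeal_le_idealF hc hr) (dualForm k n b)
    rw [mul_comm, sub_mul, map_sub, h b, Finset.sum_mul, map_sum] at h1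
    simpa [smul_mul_assoc, frob_normalForm_mul_dualForm hc] using h1
  simpa [hr0] using hr

theorem idealF_eq_genIdeal (hc : 7 ≤ c) : idealF k c = genIdeal k c := by
  refine le_antisymm (fun p hp => ?_) (genIdeal_le_idealF hc)
  rw [← sum_homogeneousComponent p]
  refine sum_mem fun n _ => mem_genIdeal_of_isHomogeneous hc
    (homogeneousComponent_isHomogeneous n p) fun b => ?_
  -- In degree 5 and above there are no normal forms, so no dual form to test against.
  have hn : n ≤ 4 := by
    by_contra! h
    obtain ⟨m, rfl⟩ := Nat.exists_eq_add_of_le' h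
    exact b.elim
  have hb := isHomogeneous_dualForm (k := k) n b
  have h1 := mem_idealF_iff.mp hp (dualForm k n b)
  rw [mul_comm] at h1
  nth_rw 1 [← sum_homogeneousComponent p] at h1
  rw [Finset.sum_mul, map_sum] at h1
  -- As `frob` sees only degree 4, pairing with a form of degree 4 - n isolates the component of
  -- degree n.
  by_cases hm : n ∈ Finset.range (p.totalDegree + 1)
  · rwa [Finset.sum_eq_single_of_mem n hm] at h1
    intro m _ hmn
    exact frob_of_isHomogeneous ((homogeneousComponent_isHomogeneous m p).mul hb) (by omega)
  · rw [homogeneousComponent_eq_zero _ _ (by simpa using hm), zero_mul, map_zero]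

theorem linearIndependent_normalForm (hc : 7 ≤ c) (n : ℕ) :
    LinearIndependent k (normalForm (fun i => Ideal.Quotient.mk (idealF k c) (X i)) n) := by
  classical
  rw [Fintype.linearIndependent_iff]
  intro r hr b
  have h0 : ∑ a, r a • normalForm X n a ∈ idealF k c := by
    rw [← Ideal.Quotient.eq_zero_iff_mem, ← hr, map_sum]
    refine Finset.sum_congr rfl fun a _ => ?_
    rw [← map_normalForm]
    exact map_smul (Ideal.Quotient.mkₐ k _) _ _
  have h1 := mem_idealF_iff.mp h0 (dualForm k n b)
  rw [mul_comm, Finset.sum_mul, map_sum] at h1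
  simpa [smul_mul_assoc, frob_normalForm_mul_dualForm hc] using h1

theorem gradingR_eq_span (hc : 7 ≤ c) (n : ℕ) : gradingR k c n =
    Submodule.span k (Set.range (normalForm (fun i => Ideal.Quotient.mk (idealF k c) (X i)) n)) := by
  refine le_antisymm ?_ ?_
  · rintro _ ⟨p, hp, rfl⟩
    exact mk_mem_span_normalForm hc (genIdeal_le_idealF hc) hp
  · rw [Submodule.span_le]
    rintro _ ⟨a, rfl⟩
    exact ⟨_, isHomogeneous_normalForm n a, map_normalForm (Ideal.Quotient.mk _) X n a⟩

theorem finrank_gradingR (hc : 7 ≤ c) (n : ℕ) :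
    Module.finrank k (gradingR k c n) = Fintype.card (NormalIndex c n) := by
  rw [gradingR_eq_span hc, finrank_span_eq_card (linearIndependent_normalForm hc n)]

theorem card_normalIndex (n : ℕ) :
    Fintype.card (NormalIndex c n) = [1, c, 2 * c, c, 1].getD n 0 := by
  match n with
  | 0 => rfl
  | 1 => exact ZMod.card c
  | 2 =>
    refine (Fintype.card_sum (α := ZMod c) (β := ZMod c)).trans ?_
    simp [ZMod.card, two_mul]
  | 3 => exact ZMod.card c
  | 4 => rfl
  | n + 5 => rfl

end Basis

/-! ### Self-injectivity from a nondegenerate functional. -/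

section Injective

variable {k : Type*} [Field k] {A : Type u} [CommRing A] [Algebra k A] [Module.Finite k A]

/-- A finite-dimensional algebra with a nondegenerate functional is self-injective. -/
theorem baer_of_nondegenerate (φ : A →ₗ[k] k) (hφ : ∀ a, (∀ b, φ (b * a) = 0) → a = 0) :
    Module.Baer A A := by
  intro I g
  let T : A →ₗ[k] Module.Dual k A := LinearMap.mk₂ k (fun a b => φ (b * a))
    (by simp [mul_add]) (by simp) (by simp [add_mul]) (by simp)
  have hT : Function.Injective T := by
    rw [injective_iff_map_eq_zero]
    exact fun a ha => hφ a fun b => LinearMap.congr_fun ha b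
  -- Nondegeneracy embeds A into its dual, and equality of dimensions makes this an isomorphism.
  have hT' : Function.Surjective T :=
    (LinearMap.injective_iff_surjective_of_finrank_eq_finrank
      (Subspace.dual_finrank_eq (K := k) (V := A)).symm).mp hT
  -- A vector space extension of φ ∘ g is represented by some r; nondegeneracy then forces g to be
  -- multiplication by r.
  obtain ⟨ψ, hψ⟩ := LinearMap.exists_extend (p := I.restrictScalars k)
    (φ ∘ₗ (g.restrictScalars k))
  obtain ⟨r, rfl⟩ := hT' ψ
  refine ⟨LinearMap.mulLeft A r, fun x hx => ?_⟩
  rw [← sub_eq_zero]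
  refine hφ _ fun b => ?_
  have e : φ (b * x * r) = φ (g (b • ⟨x, hx⟩)) :=
    LinearMap.congr_fun hψ ⟨b * x, I.mul_mem_left b hx⟩
  rw [map_smul, smul_eq_mul] at e
  rw [mul_sub, map_sub, ← e, sub_eq_zero, LinearMap.mulLeft_apply]
  congr 1
  ring

theorem isGorensteinRing_of_nondegenerate (φ : A →ₗ[k] k)
    (hφ : ∀ a, (∀ b, φ (b * a) = 0) → a = 0)
    (hu : ∀ (p : Ideal A) [p.IsPrime], ∀ r ∉ p, IsUnit r) : IsGorensteinRing A := by
  have : IsArtinianRing A := IsArtinianRing.of_finite k A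
  refine ⟨inferInstance, fun p hp => ⟨0, ?_⟩⟩
  -- Elements outside p are already invertible, so the localization is A itself and inherits the
  -- functional.
  let e : A ≃ₐ[A] Localization.AtPrime p :=
    IsLocalization.atUnits _ p.primeCompl fun r hr => hu p r hr
  let e' := (e.restrictScalars k).toLinearEquiv
  have : Module.Finite k (Localization.AtPrime p) := Module.Finite.equiv e'
  have hb : Module.Baer (Localization.AtPrime p) (Localization.AtPrime p) := by
    refine baer_of_nondegenerate (φ ∘ₗ e'.symm.toLinearMap) fun a h => ?_
    obtain ⟨a, rfl⟩ := e.surjective a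
    rw [hφ a, map_zero]
    intro b
    have := h (e b)
    rw [← map_mul] at this
    simpa [e'] using this
  have := hb.injective
  have := Module.injective_object_of_injective_module (Localization.AtPrime p)
    (Localization.AtPrime p)
  exact CategoryTheory.injective_iff_hasInjectiveDimensionLT_one.mp this

end Injective

/-! ### A height bound for ideals whose radical contains all variables. -/

section Height

variable {k : Type*} [Field k] {σ : Type*}

theorem sub_C_constantCoeff_mem {J : Ideal (MvPolynomial σ k)} (h : ∀ i, X i ∈ J)
    (p : MvPolynomial σ k) : p - C (constantCoeff p) ∈ J := by
  induction p using MvPolynomial.induction_on with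
  | C a => simp
  | add p q hp hq =>
    rw [map_add, map_add, add_sub_add_comm]
    exact add_mem hp hq
  | mul_X p i _ =>
    simpa using J.mul_mem_left p (h i)

open Classical in
/-- Setting the variables in `T` to zero. -/
noncomputable def killVars (k : Type*) [Field k] (T : Finset σ) :
    MvPolynomial σ k →ₐ[k] MvPolynomial σ k :=
  aeval fun i => if i ∈ T then 0 else X i

/-- Killing the variables one by one yields a strictly increasing chain of primes. -/
theorem card_le_height_ker_killVars (T : Finset σ) :
    (T.card : ℕ∞) ≤ (RingHom.ker (killVars k T)).height := by
  classical
  induction T using Finset.induction_on with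
  | empty => simp
  | insert j T hj ih =>
    have hp (T : Finset σ) : (RingHom.ker (killVars k T)).IsPrime := RingHom.ker_isPrime _
    have hlt : RingHom.ker (killVars k T) < RingHom.ker (killVars k (insert j T)) := by
      refine lt_of_le_of_ne (fun p hp => ?_) fun e => ?_
      · have : (killVars k (insert j T)).comp (killVars k T) = killVars k (insert j T) := by
          refine MvPolynomial.algHom_ext fun i => ?_
          by_cases hi : i ∈ T
          · simp [killVars, hi]
          · by_cases hij : i = j
            · subst hij
              simp [killVars, hi]
            · simp [killVars, hi, hij]
        rw [RingHom.mem_ker] at hp ⊢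
        rw [← this, AlgHom.comp_apply, hp, map_zero]
      · have : X j ∈ RingHom.ker (killVars k (insert j T)) := by
          simp [RingHom.mem_ker, killVars]
        rw [← e] at this
        simp [RingHom.mem_ker, killVars, hj] at this
    rw [Finset.card_insert_of_notMem hj]
    push_cast
    exact (add_le_add_left ih 1).trans (Ideal.height_add_one_le_of_lt_of_isPrime hlt)

theorem card_le_height_of_X_mem_radical [Fintype σ] {I : Ideal (MvPolynomial σ k)}
    (h : ∀ i, X i ∈ I.radical) : (Fintype.card σ : ℕ∞) ≤ I.height := by
  rw [Ideal.height_eq_inf_minimalPrimes]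
  refine le_iInf₂ fun J hJ => ?_
  have hJp : J.IsPrime := hJ.1.1
  have hX (i : σ) : X i ∈ J := (hJp.radical_le_iff.mpr hJ.1.2) (h i)
  refine (card_le_height_ker_killVars (k := k) Finset.univ).trans (Ideal.height_mono fun p hp => ?_)
  have h0 : constantCoeff p = 0 := by
    rw [RingHom.mem_ker] at hp
    have e : (constantCoeff (R := k)).comp (killVars k Finset.univ).toRingHom =
        constantCoeff (σ := σ) :=
      MvPolynomial.ringHom_ext (by simp [killVars]) (by simp [killVars])
    rw [← e, RingHom.comp_apply]
    exact (congrArg constantCoeff hp).trans (map_zero _)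
  simpa [h0] using sub_C_constantCoeff_mem hX p

end Height

/-! ### Codimension, finiteness, h-vector and the Gorenstein property of R. -/

section RingProperties

variable {k : Type u} [Field k] {c : ℕ} [NeZero c]

theorem idealF_ne_top (hc : 7 ≤ c) : idealF k c ≠ ⊤ := by
  intro h
  have h1 : (1 : MvPolynomial (ZMod c) k) ∈ idealF k c := h ▸ Submodule.mem_top
  have h2 := mem_idealF_iff.mp h1 (X 0 * X 1 * X 2 * X 2)
  rw [mul_one, frob_top hc] at h2
  exact one_ne_zero h2

theorem X_pow_three_mem_idealF (hc : 7 ≤ c) (i : ZMod c) : X i ^ 3 ∈ idealF k c := by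
  rw [← Ideal.Quotient.eq_zero_iff_mem, map_pow]
  have := (satisfiesRelations_mk hc (genIdeal_le_idealF (k := k) hc)).sq_mul_self hc i
  rw [pow_three, ← mul_assoc]
  exact this

theorem height_idealF (hc : 7 ≤ c) : (idealF k c).height = c := by
  refine le_antisymm ?_ ?_
  · have h := Ideal.height_le_ringKrullDim_of_ne_top (idealF_ne_top (k := k) hc)
    rw [MvPolynomial.ringKrullDim_of_isNoetherianRing, ringKrullDim_eq_zero_of_field, zero_add,
      Nat.card_zmod] at h
    exact_mod_cast h
  · have h := card_le_height_of_X_mem_radical (I := idealF k c)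
      fun i => ⟨3, X_pow_three_mem_idealF hc i⟩
    rwa [ZMod.card] at h

theorem finite_quotient_idealF (hc : 7 ≤ c) :
    Module.Finite k (MvPolynomial (ZMod c) k ⧸ idealF k c) := by
  set N := fun n => Submodule.span k
    (Set.range (normalForm (fun i => Ideal.Quotient.mk (idealF k c) (X i)) n)) with hN
  have h (p : MvPolynomial (ZMod c) k) : Ideal.Quotient.mk (idealF k c) p ∈ ⨆ n : Fin 5, N n := by
    rw [← sum_homogeneousComponent p, map_sum]
    refine sum_mem fun n _ => ?_
    have hn := mk_mem_span_normalForm hc (genIdeal_le_idealF hc)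
      (homogeneousComponent_isHomogeneous n p)
    by_cases h5 : n < 5
    · exact Submodule.mem_iSup_of_mem (p := fun n : Fin 5 => N n) ⟨n, h5⟩ hn
    · obtain ⟨m, rfl⟩ := Nat.exists_eq_add_of_le' (not_lt.mp h5)
      have : Set.range (normalForm (fun i => Ideal.Quotient.mk (idealF k c) (X i)) (m + 5)) = ∅ :=
        Set.range_eq_empty_iff.mpr ⟨fun b => b.elim⟩
      rw [this, Submodule.span_empty, Submodule.mem_bot] at hn
      rw [hn]
      exact zero_mem _
  have htop : (⊤ : Submodule k (MvPolynomial (ZMod c) k ⧸ idealF k c)) = ⨆ n : Fin 5, N n := by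
    refine (top_le_iff.mp fun r _ => ?_).symm
    obtain ⟨p, rfl⟩ := Ideal.Quotient.mk_surjective r
    exact h p
  refine ⟨htop ▸ Submodule.fg_iSup _ fun n => Submodule.fg_span (Set.finite_range _)⟩

theorem hasHVector_gradingR (hc : 7 ≤ c) : HasHVector (gradingR k c) [1, c, 2 * c, c, 1] := by
  have := finite_quotient_idealF (k := k) hc
  have : Nontrivial (MvPolynomial (ZMod c) k ⧸ idealF k c) :=
    Ideal.Quotient.nontrivial_iff.mpr (idealF_ne_top hc)
  have : IsArtinianRing (MvPolynomial (ZMod c) k ⧸ idealF k c) := IsArtinianRing.of_finite k _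
  -- R is Artinian, so its Krull dimension is 0 and the Hilbert series is already the h-polynomial.
  refine ⟨⟨1, by simp, one_ne_zero⟩, 0, ?_, ?_⟩
  · exact_mod_cast ringKrullDimZero_iff_ringKrullDim_eq_zero.mp inferInstance
  · ext n
    rw [pow_zero, mul_one, PowerSeries.coeff_mk, PowerSeries.coeff_mk, finrank_gradingR hc,
      card_normalIndex]

/-- Every element of R is a constant plus a nilpotent; outside a prime the constant is nonzero. -/
theorem isUnit_of_notMem_prime (hc : 7 ≤ c) (p : Ideal (MvPolynomial (ZMod c) k ⧸ idealF k c))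
    [hp : p.IsPrime] {r : MvPolynomial (ZMod c) k ⧸ idealF k c} (hr : r ∉ p) : IsUnit r := by
  obtain ⟨q, rfl⟩ := Ideal.Quotient.mk_surjective r
  have hX (i : ZMod c) : X i ∈ (nilradical _).comap (Ideal.Quotient.mk (idealF k c)) :=
    mem_nilradical.mpr
      ⟨3, by rw [← map_pow, Ideal.Quotient.eq_zero_iff_mem]; exact X_pow_three_mem_idealF hc i⟩
  have h := sub_C_constantCoeff_mem hX q
  rw [Ideal.mem_comap, map_sub] at h
  have h0 : constantCoeff q ≠ 0 := by
    intro h0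
    rw [h0, map_zero, map_zero, sub_zero] at h
    exact hr (nilradical_le_prime p h)
  have hu : IsUnit (Ideal.Quotient.mk (idealF k c) (C (constantCoeff q))) :=
    ((isUnit_iff_ne_zero.mpr h0).map C).map _
  have := (mem_nilradical.mp h).isUnit_add_left_of_commute hu (Commute.all _ _)
  rwa [add_sub_cancel] at this

theorem isGorensteinRing_quotient (hc : 7 ≤ c) :
    IsGorensteinRing (MvPolynomial (ZMod c) k ⧸ idealF k c) := by
  have := finite_quotient_idealF (k := k) hc
  refine isGorensteinRing_of_nondegenerate (((idealF k c).restrictScalars k).liftQ (frob k c)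
    fun p hp => by simpa using mem_idealF_iff.mp hp 1) (fun a h => ?_)
    fun p hp r hr => isUnit_of_notMem_prime hc p hr
  obtain ⟨a, rfl⟩ := Ideal.Quotient.mk_surjective a
  rw [Ideal.Quotient.eq_zero_iff_mem, mem_idealF_iff]
  exact fun q => h (Ideal.Quotient.mk _ q)

omit [NeZero c] in
theorem isHomogeneous_gens (a : GenIndex c) : (gens k c a).IsHomogeneous 2 := by
  have h := isHomogeneous_X (σ := ZMod c) k
  match a with
  | Sum.inl i => exact ((h i).pow 2).sub ((h _).mul (h _))
  | Sum.inr p => exact (h _).mul (h _)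

theorem isGeneratedByQuadrics_idealF (hc : 7 ≤ c) : IsGeneratedByQuadrics (idealF k c) := by
  refine ⟨Set.range (gens k c), ?_, idealF_eq_genIdeal hc⟩
  rintro _ ⟨a, rfl⟩
  exact isHomogeneous_gens a

end RingProperties

/-! ### The quadratic syzygy and its independence of linear and Koszul syzygies. -/

section Syz

variable {k : Type u} [Field k] {c : ℕ} [NeZero c]

/-- The four coefficients are those at the divisors of x_a x_b, the only terms that contraction with
y_a y_b can see. Phrasing the condition as an annihilator makes it an ideal for free. -/
theorem mem_annIdeal_monomial_of_coeff {σ : Type} {a b : σ} (hab : a ≠ b) {p : MvPolynomial σ k}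
    (h0 : coeff 0 p = 0) (ha : coeff (Finsupp.single a 1) p = 0)
    (hb : coeff (Finsupp.single b 1) p = 0)
    (hab' : coeff (Finsupp.single a 1 + Finsupp.single b 1) p = 0) :
    p ∈ annIdeal (monomial (Finsupp.single a 1 + Finsupp.single b 1) (1 : k)) := by
  classical
  show contraction p _ = 0
  ext β
  rw [coeff_contraction_monomial, coeff_zero, coeff_monomial_mul']
  split_ifs with hβ
  · rw [one_mul]
    obtain ⟨γ, hγ⟩ := exists_add_of_le hβ
    rw [hγ, add_tsub_cancel_left]
    have e (x : σ) := DFunLike.congr_fun hγ x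
    simp only [Finsupp.add_apply, Finsupp.single_apply] at e
    have hx (x : σ) (hxa : a ≠ x) (hxb : b ≠ x) : γ x = 0 := by
      have := e x
      simp only [hxa, hxb, if_false] at this
      omega
    have hγ' : γ = Finsupp.single a (γ a) + Finsupp.single b (γ b) := by
      ext x
      by_cases hxa : a = x
      · subst hxa; simp [hab]
      · by_cases hxb : b = x
        · subst hxb; simp [hab.symm]
        · simp [hx x hxa hxb, hxa, hxb]
    have ea := e a
    have eb := e b
    simp only [if_true, hab, hab.symm, if_false] at ea eb
    have ca : γ a = 0 ∨ γ a = 1 := by omega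
    have cb : γ b = 0 ∨ γ b = 1 := by omega
    rcases ca with ca | ca <;> rcases cb with cb | cb <;> rw [hγ', ca, cb] <;> simpa
  · rfl

/-- The exponent of the leading monomial of a generator. -/
noncomputable def leadExp : GenIndex c → ZMod c →₀ ℕ
  | Sum.inl i => Finsupp.single i 1 + Finsupp.single i 1
  | Sum.inr p => Finsupp.single p.1.1 1 + Finsupp.single p.1.2 1

omit [NeZero c] in
theorem gens_inl (i : ZMod c) : gens k c (Sum.inl i) =
    monomial (Finsupp.single i 1 + Finsupp.single i 1) 1 -
      monomial (Finsupp.single (i - 1) 1 + Finsupp.single (i - 3) 1) 1 := by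
  simp [gens, X, monomial_mul, sq]

omit [NeZero c] in
theorem gens_inr (p) : gens k c (Sum.inr p) =
    monomial (Finsupp.single p.1.1 1 + Finsupp.single p.1.2 1) 1 := by
  simp [gens, X, monomial_mul]

theorem single_add_single_eq_iff {σ : Type*} {a b i j : σ} :
    (Finsupp.single a 1 + Finsupp.single b 1 : σ →₀ ℕ) = Finsupp.single i 1 + Finsupp.single j 1 ↔
      a = i ∧ b = j ∨ a = j ∧ b = i := by
  rw [Finsupp.single_add_single_eq_single_add_single one_ne_zero one_ne_zero]
  simp

-- The tails x_{j-1}x_{j-3} have distance 2, so they are neither squares nor far products; hence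
-- leading monomials separate the generators.
open Classical in
theorem coeff_leadExp_gens (hc : 7 ≤ c) (a b : GenIndex c) :
    coeff (leadExp a) (gens k c b) = if b = a then 1 else 0 := by
  match a, b with
  | Sum.inl i, Sum.inl j =>
    obtain ⟨n1, n2, n3, n4, n5, n6⟩ := add_small_ne hc i
    rw [gens_inl, leadExp, coeff_sub, coeff_monomial, coeff_monomial]
    simp only [single_add_single_eq_iff, or_self, and_self, Sum.inl.injEq]
    rw [if_neg (c := j - 1 = i ∧ j - 3 = i), sub_zero]
    exact fun ⟨e, e'⟩ => n2 (by linear_combination e - e')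
  | Sum.inl i, Sum.inr p =>
    rw [gens_inr, leadExp, coeff_monomial, if_neg, if_neg (by simp)]
    rw [single_add_single_eq_iff]
    have := p.2.1
    rintro (⟨e, e'⟩ | ⟨e, e'⟩) <;> simp [e, e'] at this
  | Sum.inr p, Sum.inl j =>
    obtain ⟨n1, n2, n3, n4, n5, n6⟩ := add_small_ne hc j
    have hf := (three_le_cycAbs_iff hc _).mp p.2.2
    rw [gens_inl, leadExp, coeff_sub, coeff_monomial, coeff_monomial, if_neg, if_neg, if_neg,
      sub_zero]
    · simp
    · rw [single_add_single_eq_iff]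
      rintro (⟨e, e'⟩ | ⟨e, e'⟩)
      · exact hf.2.2.1 (by linear_combination e' - e)
      · exact hf.2.2.2.2 (by linear_combination e - e')
    · rw [single_add_single_eq_iff]
      rintro (⟨e, e'⟩ | ⟨e, e'⟩)
      · exact hf.1 (by linear_combination e' - e)
      · exact hf.1 (by linear_combination e - e')
  | Sum.inr p, Sum.inr q =>
    rw [gens_inr, leadExp, coeff_monomial]
    refine if_congr ?_ rfl rfl
    rw [single_add_single_eq_iff, Sum.inr.injEq, Subtype.ext_iff, Prod.ext_iff]
    refine or_iff_left ?_
    rintro ⟨e, e'⟩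
    have h1 := p.2.1
    have h2 := q.2.1
    rw [e, e'] at h2
    omega

theorem linearIndependent_gens (hc : 7 ≤ c) : LinearIndependent k (gens k c) := by
  classical
  rw [Fintype.linearIndependent_iff]
  intro r hr a
  have h := congrArg (coeff (leadExp a)) hr
  simpa only [coeff_sum, coeff_smul, coeff_leadExp_gens hc, smul_eq_mul, mul_ite, mul_one, mul_zero,
    Finset.sum_ite_eq', Finset.mem_univ, if_true, coeff_zero] using h

theorem isSyzygy_syzU : IsSyzygy (gens k c) (syzU k c) := by
  have h1 : ∑ a, syzU k c a * gens k c a =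
      ∑ i : ZMod c, X (i - 1) * X (i - 2) * (X i ^ 2 - X (i - 1) * X (i - 3)) +
        ∑ p : {p : ZMod c × ZMod c // p.1.val < p.2.val ∧ 3 ≤ cycAbs c (p.1 - p.2)},
          (0 : MvPolynomial (ZMod c) k) * (X p.1.1 * X p.1.2) := by
    convert Fintype.sum_sum_type _ <;> rfl
  -- Shifting the index by one turns the sum of leading terms into the sum of tails.
  have h2 : ∑ i : ZMod c, (X (i - 1) * X (i - 2) * X i ^ 2 : MvPolynomial (ZMod c) k) =
      ∑ i : ZMod c, X (i - 1 - 1) * X (i - 1 - 2) * X (i - 1) ^ 2 :=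
    ((Equiv.subRight (1 : ZMod c)).sum_comp fun i =>
      (X (i - 1) * X (i - 2) * X i ^ 2 : MvPolynomial (ZMod c) k)).symm
  rw [IsSyzygy, h1]
  simp only [zero_mul, Finset.sum_const_zero, add_zero, mul_sub, Finset.sum_sub_distrib]
  rw [h2, ← Finset.sum_sub_distrib]
  refine Finset.sum_eq_zero fun i _ => ?_
  rw [show i - 1 - 1 = i - 2 by ring, show i - 1 - 2 = i - 3 by ring]
  ring

omit [NeZero c] in
theorem isHomogeneous_syzU (a : GenIndex c) : (syzU k c a).IsHomogeneous 2 := by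
  have h := isHomogeneous_X (σ := ZMod c) k
  match a with
  | Sum.inl i => exact (h _).mul (h _)
  | Sum.inr p => exact isHomogeneous_zero _ _ _

theorem ne_zero_of_single_add_single_le {σ : Type*} {a b : σ} {γ : σ →₀ ℕ}
    (h : Finsupp.single a 1 + Finsupp.single b 1 ≤ γ) : γ a ≠ 0 ∧ γ b ≠ 0 := by
  have ha := h a
  have hb := h b
  simp only [Finsupp.add_apply, Finsupp.single_eq_same] at ha hb
  omega

open Classical in
/-- The coefficient of a combination of the generators at an exponent that only the leading
monomial of `q_j` divides. -/
theorem coeff_sum_mul_gens {v : GenIndex c → MvPolynomial (ZMod c) k} {j : ZMod c}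
    {γ : ZMod c →₀ ℕ} {r : k}
    (h1 : ∀ i, (if Finsupp.single i 1 + Finsupp.single i 1 ≤ γ then
        coeff (γ - (Finsupp.single i 1 + Finsupp.single i 1)) (v (Sum.inl i)) else 0) -
      (if Finsupp.single (i - 1) 1 + Finsupp.single (i - 3) 1 ≤ γ then
        coeff (γ - (Finsupp.single (i - 1) 1 + Finsupp.single (i - 3) 1)) (v (Sum.inl i)) else 0) =
      if i = j then r else 0)
    (h2 : ∀ a b, γ a ≠ 0 → γ b ≠ 0 → ¬ 3 ≤ cycAbs c (a - b)) (hv : IsSyzygy (gens k c) v) :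
    r = 0 := by
  have h := congrArg (coeff γ) hv
  rw [coeff_sum, coeff_zero] at h
  rw [← h, Finset.sum_eq_single (Sum.inl j)]
  · rw [gens_inl, mul_sub, coeff_sub, coeff_mul_monomial', coeff_mul_monomial', mul_one, mul_one,
      h1, if_pos rfl]
  · rintro (i | p) - hi
    · rw [gens_inl, mul_sub, coeff_sub, coeff_mul_monomial', coeff_mul_monomial', mul_one, mul_one,
        h1, if_neg (fun e : i = j => hi (e ▸ rfl))]
    · rw [gens_inr, coeff_mul_monomial', if_neg]
      intro hle
      have := ne_zero_of_single_add_single_le hle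
      exact h2 _ _ this.1 this.2 p.2.2
  · simp

section

variable {v : GenIndex c → MvPolynomial (ZMod c) k} (hv : IsSyzygy (gens k c) v) (hc : 7 ≤ c)
  (j : ZMod c)
include hv hc

theorem IsSyzygy.coeff_zero : coeff 0 (v (Sum.inl j)) = 0 := by
  classical
  obtain ⟨n1, n2, n3, n4, n5, n6⟩ := add_small_ne hc j
  refine coeff_sum_mul_gens (j := j) (γ := Finsupp.single j 1 + Finsupp.single j 1)
    (fun i => ?_) (fun a b ha hb => ?_) hv
  · rw [if_neg (c := Finsupp.single (i - 1) 1 + _ ≤ _), sub_zero]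
    · split_ifs with h1 h2 h2
      · rw [h2, tsub_self]
      · have := ne_zero_of_single_add_single_le h1
        simp [Ne.symm h2] at this
      · rw [h2] at h1
        exact absurd le_rfl h1
      · rfl
    · intro hle
      have := ne_zero_of_single_add_single_le hle
      simp [Finsupp.single_apply] at this
      exact n2 (by linear_combination this.2 - this.1)
  · simp [Finsupp.single_apply] at ha hb
    rw [three_le_cycAbs_iff hc, ← ha, ← hb]
    simp

theorem IsSyzygy.coeff_sub_one : coeff (Finsupp.single (j - 1) 1) (v (Sum.inl j)) = 0 := by
  classical
  obtain ⟨n1, n2, n3, n4, n5, n6⟩ := add_small_ne hc j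
  have hne : j - 1 ≠ j := fun e => n1 (by linear_combination -e)
  have hmem (a : ZMod c) (ha : (Finsupp.single j 1 + Finsupp.single j 1 +
      Finsupp.single (j - 1) 1 : ZMod c →₀ ℕ) a ≠ 0) : a = j ∨ a = j - 1 := by
    by_contra! h
    simp [h.1.symm, h.2.symm] at ha
  -- Among all monomials of the generators, only the square in q_j divides x_j²x_{j-1}.
  refine coeff_sum_mul_gens (j := j) (γ := Finsupp.single j 1 + Finsupp.single j 1 +
    Finsupp.single (j - 1) 1) (fun i => ?_) (fun a b ha hb => ?_) hv
  · rw [if_neg (c := Finsupp.single (i - 1) 1 + _ ≤ _), sub_zero]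
    · split_ifs with h1 h2 h2
      · rw [h2, add_tsub_cancel_left]
      · rcases hmem i (ne_zero_of_single_add_single_le h1).1 with h | h
        · exact absurd h h2
        · have := h1 i
          simp [h, hne.symm] at this
      · rw [h2] at h1
        exact absurd le_self_add h1
      · rfl
    · intro hle
      have := ne_zero_of_single_add_single_le hle
      rcases hmem _ this.1 with e | e <;> rcases hmem _ this.2 with e' | e'
      · exact n2 (by linear_combination e - e')
      · exact n1 (by linear_combination e - e')
      · exact n3 (by linear_combination e - e')
      · exact n2 (by linear_combination e - e')
  · rw [three_le_cycAbs_iff hc]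
    rcases hmem _ ha with e | e <;> rcases hmem _ hb with e' | e' <;> simp [e, e']

theorem IsSyzygy.coeff_sub_two : coeff (Finsupp.single (j - 2) 1) (v (Sum.inl j)) = 0 := by
  classical
  obtain ⟨n1, n2, n3, n4, n5, n6⟩ := add_small_ne hc j
  have hmem (a : ZMod c) (ha : (Finsupp.single (j - 1) 1 + Finsupp.single (j - 3) 1 +
      Finsupp.single (j - 2) 1 : ZMod c →₀ ℕ) a ≠ 0) : a = j - 1 ∨ a = j - 2 ∨ a = j - 3 := by
    by_contra! h
    simp [h.1.symm, h.2.1.symm, h.2.2.symm] at ha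
  -- Here the tail of q_j is the one dividing monomial: x_{j-1}x_{j-2}x_{j-3} has no square and no
  -- far pair, and its only pair at distance 2 is x_{j-1}x_{j-3}. The tail enters with a minus sign.
  rw [← neg_eq_zero]
  refine coeff_sum_mul_gens (j := j) (γ := Finsupp.single (j - 1) 1 + Finsupp.single (j - 3) 1 +
      Finsupp.single (j - 2) 1) (fun i => ?_) (fun a b ha hb => ?_) hv
  · rw [if_neg (c := Finsupp.single i 1 + _ ≤ _), zero_sub]
    · split_ifs with h1 h2 h2
      · rw [h2, add_tsub_cancel_left]
      · have := ne_zero_of_single_add_single_le h1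
        exfalso
        rcases hmem _ this.1 with e | e | e
        · exact h2 (by linear_combination e)
        · rcases hmem _ this.2 with e' | e' | e'
          · exact n3 (by linear_combination e - e')
          · exact n2 (by linear_combination e - e')
          · exact n1 (by linear_combination e - e')
        · rcases hmem _ this.2 with e' | e' | e'
          · exact n4 (by linear_combination e - e')
          · exact n3 (by linear_combination e - e')
          · exact n2 (by linear_combination e - e')
      · rw [h2] at h1
        exact absurd le_self_add h1
      · exact neg_zero
    · intro hle
      have h := hle i
      have h12 : j - 1 ≠ j - 2 := fun e => n1 (by linear_combination e)
      have h13 : j - 1 ≠ j - 3 := fun e => n2 (by linear_combination e)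
      have h23 : j - 2 ≠ j - 3 := fun e => n1 (by linear_combination e)
      simp only [Finsupp.add_apply, Finsupp.single_apply] at h
      split_ifs at h <;> grind
  · rw [three_le_cycAbs_iff hc]
    have e1 : j - 1 - (j - 2) = 1 := by ring
    have e2 : j - 1 - (j - 3) = 2 := by ring
    have e3 : j - 2 - (j - 1) = -1 := by ring
    have e4 : j - 2 - (j - 3) = 1 := by ring
    have e5 : j - 3 - (j - 1) = -2 := by ring
    have e6 : j - 3 - (j - 2) = -1 := by ring
    rcases hmem _ ha with rfl | rfl | rfl <;> rcases hmem _ hb with rfl | rfl | rfl <;>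
      simp [e1, e2, e3, e4, e5, e6]

end

variable (k c) in
/-- The vectors whose coordinate at `q_j` involves no divisor of `x_{j-1} x_{j-2}`. -/
noncomputable def avoidSubmodule (j : ZMod c) :
    Submodule (MvPolynomial (ZMod c) k) (GenIndex c → MvPolynomial (ZMod c) k) :=
  Submodule.comap (LinearMap.proj (Sum.inl j : GenIndex c))
    (annIdeal (monomial (Finsupp.single (j - 1) 1 + Finsupp.single (j - 2) 1) (1 : k)))

omit [NeZero c] in
theorem mem_avoidSubmodule_of_coeff (hc : 7 ≤ c) {j : ZMod c}
    {v : GenIndex c → MvPolynomial (ZMod c) k}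
    (h0 : coeff 0 (v (Sum.inl j)) = 0)
    (h1 : coeff (Finsupp.single (j - 1) 1) (v (Sum.inl j)) = 0)
    (h2 : coeff (Finsupp.single (j - 2) 1) (v (Sum.inl j)) = 0)
    (h12 : coeff (Finsupp.single (j - 1) 1 + Finsupp.single (j - 2) 1) (v (Sum.inl j)) = 0) :
    v ∈ avoidSubmodule k c j := by
  obtain ⟨n1, n2, n3, n4, n5, n6⟩ := add_small_ne hc j
  exact mem_annIdeal_monomial_of_coeff (fun e => n1 (by linear_combination e)) h0 h1 h2 h12

omit [NeZero c] in
theorem syzU_notMem_avoidSubmodule (j : ZMod c) : syzU k c ∉ avoidSubmodule k c j := by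
  classical
  intro h
  have h' : contraction (X (j - 1) * X (j - 2))
    (monomial (Finsupp.single (j - 1) 1 + Finsupp.single (j - 2) 1) (1 : k)) = 0 := h
  rw [X, X, monomial_mul, contraction_monomial, if_pos le_rfl] at h'
  simp at h'

/-- Multiplying by a variable moves to x_{j-1}x_{j-2} only a coefficient at x_{j-1} or x_{j-2}, and
these vanish for every syzygy. -/
theorem X_smul_syzygy_mem (hc : 7 ≤ c) {v : GenIndex c → MvPolynomial (ZMod c) k}
    (hv : IsSyzygy (gens k c) v) (i j : ZMod c) : (X i : MvPolynomial (ZMod c) k) • v ∈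
      avoidSubmodule k c j := by
  classical
  obtain ⟨n1, n2, n3, n4, n5, n6⟩ := add_small_ne hc j
  have h12 : j - 1 ≠ j - 2 := fun e => n1 (by linear_combination e)
  have z0 := hv.coeff_zero hc j
  have z1 := hv.coeff_sub_one hc j
  have z2 := hv.coeff_sub_two hc j
  apply mem_avoidSubmodule_of_coeff hc <;>
    simp only [Pi.smul_apply, smul_eq_mul, coeff_X_mul'] <;> split_ifs with hi
  · simp at hi
  · rfl
  · simp at hi
    rw [hi, tsub_self, z0]
  · rfl
  · simp at hi
    rw [hi, tsub_self, z0]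
  · rfl
  · have hi' : i = j - 1 ∨ i = j - 2 := by
      by_contra! h
      simp [h.1.symm, h.2.symm] at hi
    rcases hi' with rfl | rfl
    · rw [add_tsub_cancel_left, z2]
    · rw [add_tsub_cancel_right, z1]
  · rfl

theorem linear_syzygy_mem (hc : 7 ≤ c) {v : GenIndex c → MvPolynomial (ZMod c) k}
    (hv : IsSyzygy (gens k c) v) (h1 : ∀ a, (v a).IsHomogeneous 1) (j : ZMod c) :
    v ∈ avoidSubmodule k c j := by
  refine mem_avoidSubmodule_of_coeff hc (hv.coeff_zero hc j) (hv.coeff_sub_one hc j)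
    (hv.coeff_sub_two hc j) ((h1 _).coeff_eq_zero ?_)
  simp [Finsupp.degree_single]

/-- The monomials in the generators have index distance 0, 2 or at least 3, never 1. -/
theorem gens_mem_annIdeal (hc : 7 ≤ c) (b : GenIndex c) (j : ZMod c) : gens k c b ∈
    annIdeal (monomial (Finsupp.single (j - 1) 1 + Finsupp.single (j - 2) 1) (1 : k)) := by
  classical
  obtain ⟨n1, n2, n3, n4, n5, n6⟩ := add_small_ne hc j
  have hh := isHomogeneous_gens (k := k) b
  refine mem_annIdeal_monomial_of_coeff (fun e => n1 (by linear_combination e))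
    (hh.coeff_eq_zero ?_) (hh.coeff_eq_zero ?_) (hh.coeff_eq_zero ?_) ?_
  · simp
  · simp [Finsupp.degree_single]
  · simp [Finsupp.degree_single]
  match b with
  | Sum.inl i =>
    rw [gens_inl, coeff_sub, coeff_monomial, coeff_monomial, if_neg, if_neg, sub_zero]
    · rw [single_add_single_eq_iff]
      rintro (⟨e, e'⟩ | ⟨e, e'⟩)
      · exact n1 (by linear_combination e - e' )
      · exact n3 (by linear_combination e - e')
    · rw [single_add_single_eq_iff]
      rintro (⟨e, e'⟩ | ⟨e, e'⟩)
      · exact n1 (by linear_combination e' - e)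
      · exact n1 (by linear_combination e - e')
  | Sum.inr p =>
    have hf := (three_le_cycAbs_iff hc _).mp p.2.2
    rw [gens_inr, coeff_monomial, if_neg]
    rw [single_add_single_eq_iff]
    rintro (⟨e, e'⟩ | ⟨e, e'⟩)
    · exact hf.2.1 (by linear_combination e - e')
    · exact hf.2.2.2.1 (by linear_combination e - e')

theorem koszul_syzygy_mem (hc : 7 ≤ c) [DecidableEq (GenIndex c)] (a b : GenIndex c)
    (j : ZMod c) : Pi.single a (gens k c b) - Pi.single b (gens k c a) ∈ avoidSubmodule k c j := by
  have h (a b : GenIndex c) : (Pi.single a (gens k c b) : GenIndex c → MvPolynomial (ZMod c) k) ∈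
      avoidSubmodule k c j := by
    show (Pi.single a (gens k c b) : GenIndex c → MvPolynomial (ZMod c) k) (Sum.inl j) ∈
      annIdeal _
    rw [Pi.single_apply]
    split_ifs
    · exact gens_mem_annIdeal hc b j
    · exact zero_mem _
  exact sub_mem (h a b) (h b a)

theorem syzU_notMem_linearKoszulSyzygies (hc : 7 ≤ c) [DecidableEq (GenIndex c)] :
    syzU k c ∉ linearKoszulSyzygies (gens k c) := by
  intro h
  refine syzU_notMem_avoidSubmodule 0 (Submodule.span_le.mpr ?_ h)
  rintro v (⟨hv, h1⟩ | ⟨a, b, rfl⟩)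
  · exact linear_syzygy_mem hc hv h1 0
  · exact koszul_syzygy_mem hc a b 0

end Syz

/-! ### The total Koszul complex and a characteristic-free contracting homotopy. -/

namespace Koszul

variable {σ : Type} [LinearOrder σ] (k : Type u) [Field k]

/-- The sign of `t` in `T`. -/
def sign (t : σ) (T : Finset σ) : ℤ := (-1) ^ (T.filter (t < ·)).card

/-- The value of the Koszul differential on the basis element indexed by `T`. -/
noncomputable def diffBasis (T : Finset σ) : Finset σ →₀ MvPolynomial σ k :=
  ∑ t ∈ T, sign t T • Finsupp.single (T.erase t) (X t)

/-- The Koszul differential on the total complex. -/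
noncomputable def diff :
    (Finset σ →₀ MvPolynomial σ k) →ₗ[MvPolynomial σ k] (Finset σ →₀ MvPolynomial σ k) :=
  Finsupp.linearCombination _ (diffBasis k)

variable {k}

theorem diff_single (T : Finset σ) (p : MvPolynomial σ k) : diff k (Finsupp.single T p) =
    ∑ t ∈ T, sign t T • Finsupp.single (T.erase t) (p * X t) := by
  rw [diff, Finsupp.linearCombination_single, diffBasis, Finset.smul_sum]
  refine Finset.sum_congr rfl fun t _ => ?_
  rw [smul_comm, Finsupp.smul_single, smul_eq_mul]

/-- Since the sign counts larger elements, a new maximum gets sign 1 and flips all the others; this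
drives the inductions on the maximum. -/
theorem sign_insert_self {m : σ} {T : Finset σ} (h : ∀ t ∈ T, t < m) :
    sign m (insert m T) = 1 := by
  have : (insert m T).filter (m < ·) = ∅ := by
    ext u
    simp only [Finset.mem_filter, Finset.mem_insert, Finset.notMem_empty, iff_false]
    rintro ⟨rfl | hu, h'⟩
    · exact lt_irrefl _ h'
    · exact lt_asymm h' (h u hu)
  rw [sign, this, Finset.card_empty, pow_zero]

theorem sign_insert {m t : σ} {T : Finset σ} (h : ∀ t ∈ T, t < m) (ht : t ∈ T) :
    sign t (insert m T) = -sign t T := by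
  have hm : m ∉ T := fun hm => lt_irrefl _ (h m hm)
  rw [sign, sign, Finset.filter_insert, if_pos (h t ht), Finset.card_insert_of_notMem, pow_succ,
    mul_neg_one]
  exact fun hm' => hm (Finset.mem_filter.mp hm').1

theorem erase_insert_of_mem {m t : σ} {T : Finset σ} (h : ∀ t ∈ T, t < m) (ht : t ∈ T) :
    (insert m T).erase t = insert m (T.erase t) :=
  Finset.erase_insert_of_ne (h t ht).ne'

theorem diff_single_insert {m : σ} {T : Finset σ} (h : ∀ t ∈ T, t < m) (p : MvPolynomial σ k) :
    diff k (Finsupp.single (insert m T) p) = Finsupp.single T (p * X m) -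
      ∑ t ∈ T, sign t T • Finsupp.single (insert m (T.erase t)) (p * X t) := by
  have hm : m ∉ T := fun hm => lt_irrefl _ (h m hm)
  rw [diff_single, Finset.sum_insert hm, sign_insert_self h, one_smul, Finset.erase_insert hm,
    sub_eq_add_neg, ← Finset.sum_neg_distrib]
  congr 1
  refine Finset.sum_congr rfl fun t ht => ?_
  rw [sign_insert h ht, erase_insert_of_mem h ht, neg_smul]

/-- With m the new maximum, d(m ∧ e_T) = x_m e_T - m ∧ d(e_T), so applying d again leaves m ∧
d²(e_T). -/
theorem diff_diff_single (T : Finset σ) (p : MvPolynomial σ k) :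
    diff k (diff k (Finsupp.single T p)) = 0 := by
  induction T using Finset.induction_on_max generalizing p with
  | empty => simp [diff_single]
  | insert m T h ih =>
    let j := Finsupp.lmapDomain (MvPolynomial σ k) (MvPolynomial σ k) (insert m : Finset σ → _)
    have e : diff k (diff k (Finsupp.single (insert m T) p)) =
        j (diff k (diff k (Finsupp.single T p))) := by
      rw [diff_single_insert h, map_sub, map_sum, diff_single, diff_single, map_sum, map_sum,
        ← Finset.sum_sub_distrib]
      refine Finset.sum_congr rfl fun t ht => ?_
      have h' : ∀ u ∈ T.erase t, u < m := fun u hu => h u (Finset.mem_of_mem_erase hu)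
      rw [map_zsmul, diff_single_insert h', map_zsmul, map_zsmul, diff_single, map_sum]
      refine (smul_sub _ _ _).symm.trans ?_
      congr 1
      rw [mul_right_comm, sub_sub_cancel]
      refine Finset.sum_congr rfl fun s _ => ?_
      rw [map_zsmul]
      congr 1
      exact Finsupp.mapDomain_single.symm
    rw [e, ih, map_zero]

theorem diff_diff (x : Finset σ →₀ MvPolynomial σ k) : diff k (diff k x) = 0 := by
  induction x using Finsupp.induction_linear with
  | zero => simp
  | add x y hx hy => rw [map_add, map_add, hx, hy, add_zero]
  | single T p => exact diff_diff_single T p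

variable (k) in
/-- The contracting homotopy on `x ^ α e_T`: divide by the largest variable involved and append it
to `T`, if it is not in `T`. -/
noncomputable def homotopyBasis (T : Finset σ) (α : σ →₀ ℕ) : Finset σ →₀ MvPolynomial σ k :=
  if h : (α.support ∪ T).Nonempty then
    if (α.support ∪ T).max' h ∈ T then 0
    else Finsupp.single (insert ((α.support ∪ T).max' h) T)
      (monomial (α - Finsupp.single ((α.support ∪ T).max' h) 1) 1)
  else 0

theorem homotopyBasis_add_single {m : σ} {T : Finset σ} {α : σ →₀ ℕ} (hT : ∀ t ∈ T, t < m)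
    (hα : ∀ t ∈ α.support, t ≤ m) : homotopyBasis k T (α + Finsupp.single m 1) =
      Finsupp.single (insert m T) (monomial α 1) := by
  have hm : m ∉ T := fun hm => lt_irrefl _ (hT m hm)
  have hmem : m ∈ (α + Finsupp.single m 1).support ∪ T := by simp
  have hmax : ((α + Finsupp.single m 1).support ∪ T).max' ⟨m, hmem⟩ = m := by
    refine le_antisymm (Finset.max'_le _ _ _ fun t ht => ?_) (Finset.le_max' _ _ hmem)
    rcases Finset.mem_union.mp ht with ht | ht
    · by_contra! hlt
      rw [Finsupp.mem_support_iff, Finsupp.add_apply, Finsupp.single_eq_of_ne hlt.ne', add_zero] at ht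
      exact absurd (hα t (Finsupp.mem_support_iff.mpr ht)) (not_le.mpr hlt)
    · exact (hT t ht).le
  rw [homotopyBasis, dif_pos ⟨m, hmem⟩, hmax, if_neg hm, add_tsub_cancel_right]

theorem homotopyBasis_insert {m : σ} {T : Finset σ} {α : σ →₀ ℕ} (hT : ∀ t ∈ T, t < m)
    (hα : ∀ t ∈ α.support, t ≤ m) : homotopyBasis k (insert m T) α = 0 := by
  have hmem : m ∈ α.support ∪ insert m T := by simp
  have hmax : (α.support ∪ insert m T).max' ⟨m, hmem⟩ = m := by
    refine le_antisymm (Finset.max'_le _ _ _ fun t ht => ?_) (Finset.le_max' _ _ hmem)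
    rcases Finset.mem_union.mp ht with ht | ht
    · exact hα t ht
    · rcases Finset.mem_insert.mp ht with rfl | ht
      · exact le_rfl
      · exact (hT t ht).le
  rw [homotopyBasis, dif_pos ⟨m, hmem⟩, hmax, if_pos (Finset.mem_insert_self m T)]

variable (k) in
/-- The contracting homotopy of the Koszul complex. -/
noncomputable def homotopy :
    (Finset σ →₀ MvPolynomial σ k) →ₗ[k] (Finset σ →₀ MvPolynomial σ k) :=
  Finsupp.lsum k fun T => (basisMonomials σ k).constr k (homotopyBasis k T)

theorem homotopy_single_monomial (T : Finset σ) (α : σ →₀ ℕ) :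
    homotopy k (Finsupp.single T (monomial α 1)) = homotopyBasis k T α := by
  have h := (basisMonomials σ k).constr_basis k (homotopyBasis k T) α
  rw [coe_basisMonomials] at h
  rw [homotopy, Finsupp.lsum_single, h]

theorem homotopy_diff_single (T : Finset σ) (α : σ →₀ ℕ) :
    homotopy k (diff k (Finsupp.single T (monomial α 1))) =
      ∑ t ∈ T, sign t T • homotopyBasis k (T.erase t) (α + Finsupp.single t 1) := by
  rw [diff_single, map_sum]
  refine Finset.sum_congr rfl fun t _ => ?_
  rw [map_zsmul, X, monomial_mul, one_mul, homotopy_single_monomial]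

/-- Let m be the largest index involved. If m lies in T, the homotopy kills the element and recovers
it from the m-term of its differential. Otherwise it appends m, and the remaining terms of the two
composites cancel. -/
theorem homotopy_formula (T : Finset σ) (α : σ →₀ ℕ) (h : (α.support ∪ T).Nonempty) :
    diff k (homotopy k (Finsupp.single T (monomial α 1))) +
      homotopy k (diff k (Finsupp.single T (monomial α 1))) =
        Finsupp.single T (monomial α (1 : k)) := by
  obtain ⟨m, hm, hle⟩ : ∃ m ∈ α.support ∪ T, ∀ t ∈ α.support ∪ T, t ≤ m :=
    ⟨_, Finset.max'_mem _ h, fun t ht => Finset.le_max' _ _ ht⟩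
  have hα (t : σ) (ht : t ∈ α.support) : t ≤ m := hle t (Finset.mem_union_left _ ht)
  by_cases hmT : m ∈ T
  · obtain ⟨U, hmU, rfl⟩ : ∃ U, m ∉ U ∧ insert m U = T :=
      ⟨T.erase m, Finset.notMem_erase m T, Finset.insert_erase hmT⟩
    have hU (t : σ) (ht : t ∈ U) : t < m :=
      lt_of_le_of_ne (hle t (by simp [ht])) fun e => hmU (e ▸ ht)
    rw [homotopy_single_monomial, homotopyBasis_insert hU hα, map_zero, zero_add,
      diff_single_insert hU, map_sub, map_sum, X, monomial_mul, one_mul,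
      homotopy_single_monomial, homotopyBasis_add_single hU hα, Finset.sum_eq_zero, sub_zero]
    intro t ht
    rw [map_zsmul, X, monomial_mul, one_mul, homotopy_single_monomial, homotopyBasis_insert,
      smul_zero]
    · exact fun u hu => hU u (Finset.mem_of_mem_erase hu)
    · intro u hu
      rcases Finset.mem_union.mp (Finsupp.support_add hu) with hu | hu
      · exact hα u hu
      · rw [Finset.mem_singleton.mp (Finsupp.support_single_subset hu)]
        exact (hU t ht).le
  · have hmα : m ∈ α.support := (Finset.mem_union.mp hm).resolve_right hmT
    have hT (t : σ) (ht : t ∈ T) : t < m :=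
      lt_of_le_of_ne (hle t (Finset.mem_union_right _ ht)) fun e => hmT (e ▸ ht)
    obtain ⟨β, rfl⟩ : ∃ β, β + Finsupp.single m 1 = α := by
      refine ⟨α - Finsupp.single m 1, tsub_add_cancel_of_le ?_⟩
      simpa using Nat.one_le_iff_ne_zero.mpr (Finsupp.mem_support_iff.mp hmα)
    have hβ (t : σ) (ht : t ∈ β.support) : t ≤ m := by
      refine hα t ?_
      rw [Finsupp.mem_support_iff] at ht ⊢
      rw [Finsupp.add_apply]
      omega
    rw [homotopy_single_monomial, homotopyBasis_add_single hT hβ, diff_single_insert hT,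
      homotopy_diff_single, X, monomial_mul, one_mul, sub_add_eq_add_sub, add_sub_assoc,
      sub_eq_zero.mpr, add_zero]
    refine Finset.sum_congr rfl fun t ht => ?_
    rw [add_right_comm, homotopyBasis_add_single, X, monomial_mul, one_mul]
    · exact fun u hu => hT u (Finset.mem_of_mem_erase hu)
    · intro u hu
      rcases Finset.mem_union.mp (Finsupp.support_add hu) with hu | hu
      · exact hβ u hu
      · rw [Finset.mem_singleton.mp (Finsupp.support_single_subset hu)]
        exact (hT t ht).le

/-- The hypothesis excludes just the constant term at the empty set, which carries the homology. -/
theorem homotopy_formula_single (T : Finset σ) (p : MvPolynomial σ k)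
    (h : T.Nonempty ∨ coeff 0 p = 0) :
    diff k (homotopy k (Finsupp.single T p)) + homotopy k (diff k (Finsupp.single T p)) =
      Finsupp.single T p := by
  have key : ∀ α ∈ p.support, diff k (homotopy k (Finsupp.single T (monomial α (coeff α p)))) +
      homotopy k (diff k (Finsupp.single T (monomial α (coeff α p)))) =
        Finsupp.single T (monomial α (coeff α p)) := by
    intro α hα
    have e : (Finsupp.single T (monomial α (coeff α p)) : Finset σ →₀ MvPolynomial σ k) =
        coeff α p • Finsupp.single T (monomial α 1) := by
      rw [Finsupp.smul_single, smul_monomial, smul_eq_mul, mul_one]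
    have hd (a : k) (x : Finset σ →₀ MvPolynomial σ k) : diff k (a • x) = a • diff k x :=
      LinearMap.map_smul_of_tower _ _ _
    rw [e, map_smul, hd, hd, map_smul, ← smul_add, homotopy_formula]
    rcases h with h | h
    · exact h.mono Finset.subset_union_right
    · by_contra h0
      rw [Finset.not_nonempty_iff_eq_empty, Finset.union_eq_empty, Finsupp.support_eq_empty] at h0
      rw [h0.1, mem_support_iff] at hα
      exact hα h
  rw [p.as_sum, Finsupp.single_finsetSum, map_sum, map_sum, map_sum, map_sum,
    ← Finset.sum_add_distrib]
  exact Finset.sum_congr rfl key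

variable (k) in
/-- The part of the total Koszul complex in homological degree `i`. -/
noncomputable def part (i : ℕ) : Submodule (MvPolynomial σ k) (Finset σ →₀ MvPolynomial σ k) :=
  Finsupp.supported _ _ {T | T.card = i}

theorem diff_mem_part {i : ℕ} {x : Finset σ →₀ MvPolynomial σ k} (hx : x ∈ part k (i + 1)) :
    diff k x ∈ part k i := by
  rw [← x.sum_single, Finsupp.sum, map_sum]
  refine sum_mem fun T hT => ?_
  have hc : T.card = i + 1 := hx hT
  rw [diff_single]
  refine sum_mem fun t ht => zsmul_mem (Finsupp.single_mem_supported _ _ ?_) _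
  show (T.erase t).card = i
  rw [Finset.card_erase_of_mem ht, hc]
  rfl

theorem homotopyBasis_mem_part (T : Finset σ) (α : σ →₀ ℕ) :
    homotopyBasis k T α ∈ part k (T.card + 1) := by
  rw [homotopyBasis]
  split_ifs with h1 h2
  · exact zero_mem _
  · exact Finsupp.single_mem_supported _ _ (Finset.card_insert_of_notMem h2)
  · exact zero_mem _

theorem homotopy_mem_part {i : ℕ} {x : Finset σ →₀ MvPolynomial σ k} (hx : x ∈ part k i) :
    homotopy k x ∈ part k (i + 1) := by
  rw [← x.sum_single, Finsupp.sum, map_sum]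
  refine sum_mem fun T hT => ?_
  have hc : T.card = i := hx hT
  rw [(x T).as_sum, Finsupp.single_finsetSum, map_sum]
  refine sum_mem fun α _ => ?_
  have e : (Finsupp.single T (monomial α (coeff α (x T))) : Finset σ →₀ MvPolynomial σ k) =
      coeff α (x T) • Finsupp.single T (monomial α 1) := by
    rw [Finsupp.smul_single, smul_monomial, smul_eq_mul, mul_one]
  rw [e, map_smul, homotopy_single_monomial, ← hc]
  exact Submodule.smul_of_tower_mem _ _ (homotopyBasis_mem_part T α)

theorem homotopy_formula_of_mem_part {i : ℕ} {x : Finset σ →₀ MvPolynomial σ k}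
    (hx : x ∈ part k (i + 1)) : diff k (homotopy k x) + homotopy k (diff k x) = x := by
  have key : ∀ T ∈ x.support, diff k (homotopy k (Finsupp.single T (x T))) +
      homotopy k (diff k (Finsupp.single T (x T))) = Finsupp.single T (x T) := by
    intro T hT
    have hc : T.card = i + 1 := hx hT
    exact homotopy_formula_single T _ (Or.inl (Finset.card_pos.mp (by omega)))
  conv_rhs => rw [← x.sum_single]
  conv_lhs => rw [← x.sum_single]
  rw [Finsupp.sum, map_sum, map_sum, map_sum, map_sum, ← Finset.sum_add_distrib]
  exact Finset.sum_congr rfl key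

theorem exists_diff_eq {i : ℕ} {x : Finset σ →₀ MvPolynomial σ k}
    (hx : x ∈ part k (i + 1)) (h : diff k x = 0) : ∃ y ∈ part k (i + 2), diff k y = x := by
  refine ⟨homotopy k x, homotopy_mem_part hx, ?_⟩
  have := homotopy_formula_of_mem_part hx
  rwa [h, map_zero, add_zero] at this

theorem exists_diff_eq_single {p : MvPolynomial σ k} (h : coeff 0 p = 0) :
    ∃ y ∈ part k 1, diff k y = Finsupp.single (∅ : Finset σ) p := by
  refine ⟨homotopy k (Finsupp.single ∅ p),
    homotopy_mem_part (Finsupp.single_mem_supported _ _ Finset.card_empty), ?_⟩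
  have := homotopy_formula_single ∅ p (Or.inr h)
  rwa [diff_single, Finset.sum_empty, map_zero, add_zero] at this

end Koszul

/-! ### The Koszul complex as a graded free resolution of the residue field. -/

namespace Koszul

section Resolution

variable {σ : Type} [LinearOrder σ] (k : Type u) [Field k]

/-- The index set of the basis of the Koszul complex in homological degree `i`. -/
abbrev Index (σ : Type) (i : ℕ) : Type u := ULift.{u} {T : Finset σ // T.card = i}

omit [LinearOrder σ] in
theorem index_injective (i : ℕ) :
    Function.Injective fun a : Index.{u} σ i => a.down.1 :=
  fun _ _ h => ULift.down_injective (Subtype.ext h)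

/-- The inclusion of homological degree `i` into the total Koszul complex. -/
noncomputable def incl (i : ℕ) : (Index.{u} σ i →₀ MvPolynomial σ k) →ₗ[MvPolynomial σ k]
    (Finset σ →₀ MvPolynomial σ k) :=
  Finsupp.lmapDomain _ _ fun a => a.down.1

/-- The projection of the total Koszul complex onto homological degree `i`. -/
noncomputable def proj (i : ℕ) : (Finset σ →₀ MvPolynomial σ k) →ₗ[MvPolynomial σ k]
    (Index.{u} σ i →₀ MvPolynomial σ k) :=
  Finsupp.lcomapDomain (fun a => a.down.1) (index_injective i)

variable {k}

omit [LinearOrder σ] in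
theorem incl_injective (i : ℕ) : Function.Injective (incl (σ := σ) k i) :=
  Finsupp.mapDomain_injective (index_injective i)

omit [LinearOrder σ] in
theorem incl_mem_part {i : ℕ} (x : Index.{u} σ i →₀ MvPolynomial σ k) : incl k i x ∈ part k i := by
  induction x using Finsupp.induction_linear with
  | zero => rw [map_zero]; exact zero_mem _
  | add x y hx hy => rw [map_add]; exact add_mem hx hy
  | single a p =>
    rw [incl, Finsupp.lmapDomain_apply, Finsupp.mapDomain_single]
    exact Finsupp.single_mem_supported _ _ a.down.2

omit [LinearOrder σ] in
theorem incl_proj {i : ℕ} {x : Finset σ →₀ MvPolynomial σ k} (hx : x ∈ part k i) :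
    incl k i (proj k i x) = x := by
  refine Finsupp.mapDomain_comapDomain _ (index_injective i) _ fun T hT => ?_
  exact ⟨⟨⟨T, hx hT⟩⟩, rfl⟩

variable (k) in
/-- The Koszul differential in homological degree `i + 1`. -/
noncomputable def d (i : ℕ) : (Index.{u} σ (i + 1) →₀ MvPolynomial σ k) →ₗ[MvPolynomial σ k]
    (Index.{u} σ i →₀ MvPolynomial σ k) :=
  proj k i ∘ₗ diff k ∘ₗ incl k (i + 1)

theorem incl_d (i : ℕ) (x : Index.{u} σ (i + 1) →₀ MvPolynomial σ k) :
    incl k i (d k i x) = diff k (incl k (i + 1) x) :=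
  incl_proj (diff_mem_part (incl_mem_part x))

theorem diffBasis_apply_isHomogeneous (T U : Finset σ) :
    (diff k (Finsupp.single T 1) U).IsHomogeneous 1 := by
  rw [diff_single, Finsupp.finsetSum_apply]
  refine IsHomogeneous.sum _ _ _ fun t _ => ?_
  rw [Finsupp.smul_apply, Finsupp.single_apply, one_mul]
  rw [← mem_homogeneousSubmodule]
  refine zsmul_mem ?_ _
  split_ifs
  · exact isHomogeneous_X k t
  · exact isHomogeneous_zero _ _ _

theorem exact_d (i : ℕ) : Function.Exact (d (σ := σ) k (i + 1)) (d k i) := by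
  intro x
  constructor
  · intro h
    have h' : diff k (incl k (i + 1) x) = 0 := by rw [← incl_d, h, map_zero]
    obtain ⟨y, hy, e⟩ := exists_diff_eq (incl_mem_part x) h'
    refine ⟨proj k (i + 2) y, incl_injective _ ?_⟩
    rw [incl_d, incl_proj hy, e]
  · rintro ⟨y, rfl⟩
    apply incl_injective
    rw [incl_d, incl_d, diff_diff, map_zero]

variable (σ k) in
/-- The element of the index set in homological degree `0`. -/
def emptyIndex : Index.{u} σ 0 := ⟨⟨∅, Finset.card_empty⟩⟩

omit [LinearOrder σ] in
theorem eq_emptyIndex (a : Index.{u} σ 0) : a = emptyIndex σ :=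
  index_injective 0 (Finset.card_eq_zero.mp a.down.2)

omit [LinearOrder σ] in
theorem coeff_zero_of_mem_irrelevantIdeal {p : MvPolynomial σ k}
    (hp : p ∈ irrelevantIdeal (homogeneousSubmodule σ k)) : coeff 0 p = 0 := by
  have h : irrelevantIdeal (homogeneousSubmodule σ k) ≤ RingHom.ker (constantCoeff (σ := σ)) := by
    refine Ideal.span_le.mpr ?_
    rintro a ⟨n, hn, ha⟩
    exact IsHomogeneous.coeff_eq_zero ha (by simpa using hn.ne)
  exact h hp

variable (σ k) in
/-- The augmentation of the Koszul complex. -/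
noncomputable def ε : (Index.{u} σ 0 →₀ MvPolynomial σ k) →ₗ[MvPolynomial σ k]
    (MvPolynomial σ k ⧸ irrelevantIdeal (homogeneousSubmodule σ k)) :=
  (irrelevantIdeal (homogeneousSubmodule σ k)).mkQ ∘ₗ Finsupp.lapply (emptyIndex σ)

theorem exact_ε : Function.Exact (d k 0) (ε σ k) := by
  intro x
  have hε : ε σ k x = 0 ↔ x (emptyIndex σ) ∈ irrelevantIdeal (homogeneousSubmodule σ k) :=
    Submodule.Quotient.mk_eq_zero _
  have hx : incl k 0 x = Finsupp.single ∅ (x (emptyIndex σ)) := by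
    have : x = Finsupp.single (emptyIndex σ) (x (emptyIndex σ)) := by
      ext1 a
      rw [eq_emptyIndex a, Finsupp.single_eq_same]
    conv_lhs => rw [this]
    exact Finsupp.mapDomain_single
  rw [hε]
  constructor
  · intro h
    obtain ⟨y, hy, e⟩ := exists_diff_eq_single (coeff_zero_of_mem_irrelevantIdeal h)
    refine ⟨proj k 1 y, incl_injective _ ?_⟩
    rw [incl_d, incl_proj hy, e, hx]
  · rintro ⟨y, rfl⟩
    clear hx hε
    induction y using Finsupp.induction_linear with
    | zero => simp
    | add x y hx hy => rw [map_add]; exact add_mem hx hy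
    | single a p =>
      have : (Finsupp.single a p : Index.{u} σ 1 →₀ MvPolynomial σ k) =
        p • Finsupp.single a 1 := by simp
      rw [this, map_smul]
      refine Ideal.mul_mem_left _ p (Ideal.subset_span ⟨1, one_pos, ?_⟩)
      have h : incl k 1 (Finsupp.single a 1) = Finsupp.single a.down.1 1 := Finsupp.mapDomain_single
      show (diff k (incl k 1 (Finsupp.single a 1)) ∅).IsHomogeneous 1
      rw [h]
      exact diffBasis_apply_isHomogeneous _ _

theorem d_single_isHomogeneous (i : ℕ) (b : Index.{u} σ (i + 1)) (a : Index.{u} σ i) :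
    (d k i (Finsupp.single b 1) a).IsHomogeneous 1 := by
  have h : incl k (i + 1) (Finsupp.single b 1) = Finsupp.single b.down.1 1 :=
    Finsupp.mapDomain_single
  show (diff k (incl k (i + 1) (Finsupp.single b 1)) a.down.1).IsHomogeneous 1
  rw [h]
  exact diffBasis_apply_isHomogeneous _ _

variable (σ k) in
/-- The Koszul resolution of the residue field of a polynomial ring. -/
noncomputable def resolution : GradedFreeResolution (homogeneousSubmodule σ k)
    (quotientGrading (homogeneousSubmodule σ k)
      (irrelevantIdeal (homogeneousSubmodule σ k))) where
  ι := Index σ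
  deg i _ := i
  d := d k
  ε := ε σ k
  d_mem i b a n hn := by
    obtain rfl : n = 1 := by omega
    exact d_single_isHomogeneous i b a
  d_eq_zero i b a h := by omega
  ε_mem a := by
    refine ⟨1, isHomogeneous_one _ _, ?_⟩
    rw [eq_emptyIndex a]
    simp [ε]
  ε_surjective := by
    intro y
    obtain ⟨p, rfl⟩ := Submodule.mkQ_surjective _ y
    exact ⟨Finsupp.single (emptyIndex σ) p, by simp [ε]⟩
  exact_zero := exact_ε
  exact_succ := exact_d

end Resolution

end Koszul

/-! ### Regularity from Koszul homology. -/

section Regularity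

variable {k : Type u} [Field k] {c : ℕ} [NeZero c]

theorem gradingR_eq_bot (hc : 7 ≤ c) {n : ℕ} (hn : 5 ≤ n) : gradingR k c n = ⊥ := by
  obtain ⟨m, rfl⟩ := Nat.exists_eq_add_of_le' hn
  rw [gradingR_eq_span hc, Set.range_eq_empty_iff.mpr ⟨fun b => b.elim⟩, Submodule.span_empty]

theorem smul_gradingR_four (hc : 7 ≤ c) {p : MvPolynomial (ZMod c) k} (hp : p.IsHomogeneous 1)
    {w : MvPolynomial (ZMod c) k ⧸ idealF k c} (hw : w ∈ gradingR k c 4) : p • w = 0 := by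
  obtain ⟨q, hq, rfl⟩ := hw
  have : p • (Ideal.Quotient.mkₐ k (idealF k c)).toLinearMap q ∈ gradingR k c 5 :=
    ⟨p * q, (by simpa using! hp.mul hq : (p * q).IsHomogeneous 5), rfl⟩
  rw [gradingR_eq_bot hc le_rfl] at this
  exact this

variable (k c) in
/-- The generator of the socle of `R`. -/
noncomputable def socle : MvPolynomial (ZMod c) k ⧸ idealF k c :=
  Ideal.Quotient.mk _ (X 0 * X 1 * X 2 * X 2)

theorem socle_ne_zero (hc : 7 ≤ c) : socle k c ≠ 0 := by
  rw [socle, Ne, Ideal.Quotient.eq_zero_iff_mem, mem_idealF_iff]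
  intro h
  have := h 1
  rw [one_mul, frob_top hc] at this
  exact one_ne_zero this

theorem gradingR_four (hc : 7 ≤ c) : gradingR k c 4 = Submodule.span k {socle k c} := by
  rw [gradingR_eq_span hc]
  congr 1
  ext y
  constructor
  · rintro ⟨b, rfl⟩
    simp [normalForm, socle]
  · rintro rfl
    exact ⟨(), by simp [normalForm, socle]⟩

/-- In homological degree c the Koszul complex has one basis element and nothing above it. Linear
forms kill the socle, so the socle generator there is a cycle, and there are no boundaries. Writing
c as a successor matches the case split in `GradedFreeResolution.cycles`. -/
theorem torDim_koszul_ne_zero (hc : 7 ≤ c) [LinearOrder (ZMod c)] {e : ℕ} (he : c = e + 1) :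
    (Koszul.resolution (ZMod c) k).torDim (gradingR k c) (e + 1) (e + 1 + 4) ≠ 0 := by
  set F := Koszul.resolution (ZMod c) k with hF
  have hcard : Fintype.card (ZMod c) = e + 1 := (ZMod.card c).trans he
  let a₀ : F.ι (e + 1) := ⟨⟨Finset.univ, hcard⟩⟩
  have ha (a : F.ι (e + 1)) : a = a₀ :=
    Koszul.index_injective _ (Finset.card_eq_iff_eq_univ _ |>.mp (a.down.2.trans hcard.symm))
  have hempty : IsEmpty (F.ι (e + 1 + 1)) := ⟨fun a => by
    have h1 := a.down.2
    have h2 := Finset.card_le_univ a.down.1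
    omega⟩
  let t₀ : (MvPolynomial (ZMod c) k ⧸ idealF k c) ⊗[MvPolynomial (ZMod c) k]
    (F.ι (e + 1) →₀ MvPolynomial (ZMod c) k) := socle k c ⊗ₜ Finsupp.single a₀ 1
  have ht₀ : t₀ ≠ 0 := by
    intro h
    have := congrArg ((TensorProduct.rid _ _).toLinearMap ∘ₗ
      (Finsupp.lapply a₀ : (F.ι (e + 1) →₀ MvPolynomial (ZMod c) k) →ₗ[_] _).lTensor
        (MvPolynomial (ZMod c) k ⧸ idealF k c)) h
    rw [map_zero] at this
    exact socle_ne_zero hc (by simpa [t₀] using this)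
  have hsoc : socle k c ∈ gradingR k c 4 := by
    rw [gradingR_four hc]
    exact Submodule.mem_span_singleton_self _
  have hcomp : F.tensorComponent (gradingR k c) (e + 1) (e + 1 + 4) ≤ Submodule.span k {t₀} := by
    refine Submodule.span_le.mpr ?_
    rintro _ ⟨a, n, x, hn, hx, rfl⟩
    have hn' : n + (e + 1) = e + 1 + 4 := hn
    obtain rfl : n = 4 := by omega
    rw [gradingR_four hc, Submodule.mem_span_singleton] at hx
    obtain ⟨r, rfl⟩ := hx
    rw [ha a, ← TensorProduct.smul_tmul']
    exact Submodule.smul_mem _ _ (Submodule.mem_span_singleton_self _)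
  have hcyc : t₀ ∈ F.cyclesComponent (gradingR k c) (e + 1) (e + 1 + 4) := by
    refine ⟨?_, Submodule.subset_span ⟨a₀, 4, socle k c, Nat.add_comm _ _, hsoc, rfl⟩⟩
    show (F.d e).lTensor _ t₀ = 0
    rw [LinearMap.lTensor_tmul, ← Finsupp.sum_single (F.d e _), Finsupp.sum,
      TensorProduct.tmul_sum]
    refine Finset.sum_eq_zero fun b _ => ?_
    rw [← mul_one (F.d e _ b), ← smul_eq_mul, ← Finsupp.smul_single, ← TensorProduct.smul_tmul]
    have h : F.d e (Finsupp.single a₀ 1) b • socle k c = 0 :=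
      smul_gradingR_four hc (Koszul.d_single_isHomogeneous e a₀ b) hsoc
    rw [h, TensorProduct.zero_tmul]
  have hbd : F.boundaries (MvPolynomial (ZMod c) k ⧸ idealF k c) (e + 1) = ⊥ := by
    have : F.d (e + 1) = 0 := LinearMap.ext fun x => by
      rw [Subsingleton.elim x 0, map_zero, map_zero]
    rw [GradedFreeResolution.boundaries, this, LinearMap.lTensor_zero, LinearMap.range_zero]
  -- Finiteness is essential: `finrank` would be 0 on an infinite-dimensional space.
  have : Module.Finite k (F.cyclesComponent (gradingR k c) (e + 1) (e + 1 + 4)) :=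
    Submodule.finiteDimensional_of_le (inf_le_right.trans hcomp)
  have : Nontrivial (F.TorComponent (gradingR k c) (e + 1) (e + 1 + 4)) := by
    refine ⟨Submodule.Quotient.mk ⟨t₀, hcyc⟩, 0, fun h => ht₀ ?_⟩
    rw [Submodule.Quotient.mk_eq_zero, hbd] at h
    exact h
  exact Module.finrank_pos.ne'

theorem hasRegularity_gradingR (hc : 7 ≤ c) :
    HasRegularity (polyGrading k c) (gradingR k c) 4 := by
  let _ : LinearOrder (ZMod c) := LinearOrder.lift' ZMod.val (ZMod.val_injective c)
  refine ⟨Koszul.resolution (ZMod c) k, ?_, ?_⟩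
  · obtain ⟨e, he⟩ : ∃ e, c = e + 1 := ⟨c - 1, by omega⟩
    exact ⟨e + 1, torDim_koszul_ne_zero hc he⟩
  · rintro j ⟨i, h⟩
    by_contra! hj
    apply h
    set F := Koszul.resolution (ZMod c) k with hF
    have h0 : F.tensorComponent (gradingR k c) i (i + j) = ⊥ := by
      rw [GradedFreeResolution.tensorComponent, Submodule.span_eq_bot]
      rintro _ ⟨a, n, x, hn, hx, rfl⟩
      have hn' : n + i = i + j := hn
      rw [gradingR_eq_bot hc (by omega), Submodule.mem_bot] at hx
      rw [hx, TensorProduct.zero_tmul]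
    have h1 : F.cyclesComponent (gradingR k c) i (i + j) = ⊥ := by
      rw [GradedFreeResolution.cyclesComponent, h0, inf_bot_eq]
    have : Subsingleton (F.cyclesComponent (gradingR k c) i (i + j)) := by
      rw [h1]; infer_instance
    exact Module.finrank_zero_of_subsingleton

end Regularity

/-! ### Comparison of two resolutions in low degrees. -/

section Comparison

variable {R : Type*} [CommRing R]

theorem exists_comp_eq_of_range_le {P A B : Type*} [AddCommGroup P] [Module R P]
    [Module.Projective R P] [AddCommGroup A] [Module R A] [AddCommGroup B] [Module R B]
    (f : A →ₗ[R] B) (g : P →ₗ[R] B) (h : ∀ x, g x ∈ LinearMap.range f) :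
    ∃ l : P →ₗ[R] A, f ∘ₗ l = g := by
  obtain ⟨l, hl⟩ := Module.projective_lifting_property f.rangeRestrict
    (g.codRestrict (LinearMap.range f) h) f.surjective_rangeRestrict
  refine ⟨l, LinearMap.ext fun x => ?_⟩
  exact congrArg Subtype.val (LinearMap.congr_fun hl x)

variable {K F₀ F₁ F₂ F₃ C₀ C₁ C₂ : Type*}
  [AddCommGroup K] [AddCommGroup F₀] [AddCommGroup F₁] [AddCommGroup F₂] [AddCommGroup F₃]
  [AddCommGroup C₀] [AddCommGroup C₁] [AddCommGroup C₂]
  [Module R K] [Module R F₀] [Module R F₁] [Module R F₂] [Module R F₃]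
  [Module R C₀] [Module R C₁] [Module R C₂]
  [Module.Projective R C₀] [Module.Projective R C₁] [Module.Projective R C₂]

/-- If `ψ` is a map from a resolution to the beginning of a projective resolution of the same
module, then the minimal cycles in degree `2` come from the third module of the source. -/
theorem exists_sub_mem_smul_ker {ε : F₀ →ₗ[R] K} {d₀ : F₁ →ₗ[R] F₀} {d₁ : F₂ →ₗ[R] F₁}
    {d₂ : F₃ →ₗ[R] F₂} (hε : Function.Surjective ε) (h₀ : Function.Exact d₀ ε)
    (h₁ : Function.Exact d₁ d₀) (h₂ : Function.Exact d₂ d₁)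
    {η : C₀ →ₗ[R] K} {D₁ : C₁ →ₗ[R] C₀} {D₂ : C₂ →ₗ[R] C₁}
    (k₀ : Function.Exact D₁ η) (k₁ : Function.Exact D₂ D₁)
    {ψ₀ : F₀ →ₗ[R] C₀} {ψ₁ : F₁ →ₗ[R] C₁} {ψ₂ : F₂ →ₗ[R] C₂}
    (e₀ : η ∘ₗ ψ₀ = ε) (e₁ : D₁ ∘ₗ ψ₁ = ψ₀ ∘ₗ d₀) (e₂ : D₂ ∘ₗ ψ₂ = ψ₁ ∘ₗ d₁)
    (I : Ideal R) {z : C₂} (hz : D₂ z = 0) (hzI : z ∈ I • (⊤ : Submodule R C₂)) :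
    ∃ f : F₃, z - ψ₂ (d₂ f) ∈ I • LinearMap.ker D₂ := by
  replace e₀ := LinearMap.congr_fun e₀
  replace e₁ := LinearMap.congr_fun e₁
  replace e₂ := LinearMap.congr_fun e₂
  simp only [LinearMap.comp_apply] at e₀ e₁ e₂
  -- A comparison map φ in the opposite direction, from the projective complex to the given
  -- resolution.
  obtain ⟨φ₀, p₀⟩ := exists_comp_eq_of_range_le ε η fun x => hε _
  replace p₀ := LinearMap.congr_fun p₀
  obtain ⟨φ₁, p₁⟩ := exists_comp_eq_of_range_le d₀ (φ₀ ∘ₗ D₁) fun x =>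
    (h₀ _).mp ((p₀ _).trans (k₀.apply_apply_eq_zero x))
  replace p₁ := LinearMap.congr_fun p₁
  obtain ⟨φ₂, p₂⟩ := exists_comp_eq_of_range_le d₁ (φ₁ ∘ₗ D₂) fun x =>
    (h₁ _).mp ((p₁ _).trans (by rw [LinearMap.comp_apply, k₁.apply_apply_eq_zero, map_zero]))
  replace p₂ := LinearMap.congr_fun p₂
  simp only [LinearMap.comp_apply] at p₀ p₁ p₂
  -- The composite ψφ lifts the identity; s is the start of a homotopy between them.
  obtain ⟨s₀, q₀⟩ := exists_comp_eq_of_range_le D₁ (ψ₀ ∘ₗ φ₀ - LinearMap.id) fun x =>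
    (k₀ _).mp (by simp [e₀, p₀])
  replace q₀ := LinearMap.congr_fun q₀
  simp only [LinearMap.comp_apply, LinearMap.sub_apply, LinearMap.id_apply] at q₀
  obtain ⟨s₁, q₁⟩ := exists_comp_eq_of_range_le D₂ (ψ₁ ∘ₗ φ₁ - LinearMap.id - s₀ ∘ₗ D₁) fun x =>
    (k₁ _).mp (by simp [e₁, p₁, q₀])
  replace q₁ := LinearMap.congr_fun q₁
  simp only [LinearMap.comp_apply, LinearMap.sub_apply, LinearMap.id_apply] at q₁
  -- The failure of the homotopy in degree 2 takes values in cycles. By linearity it sends I·C₂ into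
  -- I times the cycles, and on z it equals ψ₂φ₂z - z.
  let n : C₂ →ₗ[R] C₂ := ψ₂ ∘ₗ φ₂ - LinearMap.id - s₁ ∘ₗ D₂
  have hn : LinearMap.range n ≤ LinearMap.ker D₂ := by
    rintro _ ⟨x, rfl⟩
    simp [n, e₂, p₂, q₁, k₁.apply_apply_eq_zero]
  obtain ⟨f, hf⟩ := (h₂ (φ₂ z)).mp (by rw [p₂, hz, map_zero])
  refine ⟨f, ?_⟩
  have e : z - ψ₂ (d₂ f) = -n z := by
    simp [n, hf, hz]
  rw [e]
  refine neg_mem (Submodule.smul_mono le_rfl hn ?_)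
  rw [LinearMap.range_eq_map, ← Submodule.map_smul'']
  exact Submodule.mem_map_of_mem hzI

end Comparison

/-! ### Extracting constant coefficients from homogeneous combinations. -/

section DegreePart

variable {k : Type*} [Field k] {σ : Type*}

theorem homogeneousComponent_mul_of_isHomogeneous (s : MvPolynomial σ k) {q : MvPolynomial σ k}
    {n : ℕ} (hq : q.IsHomogeneous n) : homogeneousComponent n (s * q) = coeff 0 s • q := by
  conv_lhs => rw [← sum_homogeneousComponent s]
  rw [Finset.sum_mul, map_sum, Finset.sum_eq_single_of_mem 0 (by simp)]
  · rw [homogeneousComponent_zero, ← smul_eq_C_mul, map_smul, homogeneousComponent_of_mem hq,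
      if_pos rfl]
  · intro m _ hm
    rw [homogeneousComponent_of_mem ((homogeneousComponent_isHomogeneous m s).mul hq), if_neg]
    omega

/-- A combination of vectors of forms of degree `n` that is itself a vector of forms of degree
`n` is a combination with constant coefficients. -/
theorem exists_const_combination {ι τ : Type*} [Fintype ι] {q : ι → τ → MvPolynomial σ k} {n : ℕ}
    (hq : ∀ b i, (q b i).IsHomogeneous n) {p : τ → MvPolynomial σ k}
    (hp : ∀ i, (p i).IsHomogeneous n)
    (h : p ∈ Submodule.span (MvPolynomial σ k) (Set.range q)) :
    ∃ r : ι → k, ∀ i, p i = ∑ b, C (r b) * q b i := by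
  rw [Submodule.mem_span_range_iff_exists_fun] at h
  obtain ⟨s, rfl⟩ := h
  refine ⟨fun b => coeff 0 (s b), fun i => ?_⟩
  have := homogeneousComponent_of_mem (m := n) (hp i)
  rw [if_pos rfl] at this
  rw [← this]
  simp only [Finset.sum_apply, Pi.smul_apply, smul_eq_mul, map_sum]
  refine Finset.sum_congr rfl fun b _ => ?_
  rw [homogeneousComponent_mul_of_isHomogeneous _ (hq b i), smul_eq_C_mul]

theorem exists_const_combination_of_mem_span {ι : Type*} [Fintype ι] {q : ι → MvPolynomial σ k}
    {n : ℕ} (hq : ∀ b, (q b).IsHomogeneous n) {p : MvPolynomial σ k} (hp : p.IsHomogeneous n)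
    (h : p ∈ Ideal.span (Set.range q)) : ∃ r : ι → k, p = ∑ b, C (r b) * q b := by
  rw [Ideal.mem_span_range_iff_exists_fun] at h
  obtain ⟨s, hs⟩ := h
  obtain ⟨r, hr⟩ := exists_const_combination (τ := Unit) (q := fun b _ => q b) (p := fun _ => p)
    (fun b _ => hq b) (fun _ => hp)
    ((Submodule.mem_span_range_iff_exists_fun _).mpr ⟨s, by ext1; simpa using hs⟩)
  exact ⟨r, hr ()⟩

end DegreePart

/-! ### Syzygies on the variables. -/

namespace Koszul

section FirstSyzygies

/-- The Koszul relations between the variables. -/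
noncomputable def relation {σ : Type} [DecidableEq σ] (k : Type u) [Field k] (b : σ × σ) :
    σ → MvPolynomial σ k :=
  Pi.single b.2 (X b.1) - Pi.single b.1 (X b.2)

variable {σ : Type} [LinearOrder σ] {k : Type u} [Field k]

theorem sign_singleton (a : σ) : sign a {a} = 1 := by
  simpa using sign_insert_self (m := a) (T := ∅) (by simp)

theorem singleton_diff_mem_span (T : Finset σ) (hT : T.card = 2) (p : MvPolynomial σ k) :
    (fun i => diff k (Finsupp.single T p) {i}) ∈
      Submodule.span (MvPolynomial σ k) (Set.range (relation (σ := σ) k)) := by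
  obtain ⟨a, b, hab, rfl⟩ : ∃ a b, a < b ∧ T = insert b {a} := by
    obtain ⟨a, b, hab, rfl⟩ := Finset.card_eq_two.mp hT
    rcases lt_or_gt_of_ne hab with h | h
    · exact ⟨a, b, h, Finset.pair_comm a b⟩
    · exact ⟨b, a, h, rfl⟩
  have e : (fun i => diff k (Finsupp.single (insert b {a}) p) {i}) = p • relation k (b, a) := by
    rw [diff_single_insert (by simpa using hab)]
    ext1 i
    simp only [Finset.sum_singleton, sign_singleton, one_smul, Finsupp.sub_apply, relation, Pi.smul_apply,
      Pi.sub_apply, smul_eq_mul, Finset.erase_singleton, Finsupp.single_apply, mul_sub,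
      Pi.single_apply, insert_empty_eq, Finset.singleton_inj, mul_ite, mul_zero, eq_comm]
  rw [e]
  exact Submodule.smul_mem _ _ (Submodule.subset_span ⟨_, rfl⟩)

/-- Exactness of the Koszul complex in homological degree 1, read off on singletons. -/
theorem mem_span_relation [Fintype σ] {p : σ → MvPolynomial σ k} (hp : ∑ i, p i * X i = 0) :
    p ∈ Submodule.span (MvPolynomial σ k) (Set.range (relation (σ := σ) k)) := by
  let x : Finset σ →₀ MvPolynomial σ k := ∑ i, Finsupp.single {i} (p i)
  have hx : x ∈ part k (0 + 1) :=
    sum_mem fun i _ => Finsupp.single_mem_supported _ _ (Finset.card_singleton i)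
  have hd : diff k x = 0 := by
    have (i : σ) : diff k (Finsupp.single {i} (p i)) = Finsupp.single ∅ (p i * X i) := by
      rw [diff_single, Finset.sum_singleton, sign_singleton, one_smul, Finset.erase_singleton]
    simp only [x, map_sum, this]
    rw [← Finsupp.single_finsetSum, hp, Finsupp.single_zero]
  obtain ⟨y, hy, e⟩ := exists_diff_eq hx hd
  have hp' : p = fun i => diff k y {i} := by
    rw [e]
    ext1 i
    simp [x, Finsupp.finsetSum_apply, Finsupp.single_apply]
  have hy' : diff k y = ∑ T ∈ y.support, diff k (Finsupp.single T (y T)) := by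
    rw [← map_sum]
    exact congrArg _ y.sum_single.symm
  have : p = ∑ T ∈ y.support, fun i => diff k (Finsupp.single T (y T)) {i} := by
    rw [hp']
    ext1 i
    rw [hy', Finsupp.finsetSum_apply, Finset.sum_apply]
  rw [this]
  exact sum_mem fun T hT => singleton_diff_mem_span T (hy hT) _

end FirstSyzygies

end Koszul

/-! ### The start of a resolution over R and the lifting obstruction. -/

section NotKoszul

variable (k : Type u) [Field k] (c : ℕ)

/-- The ring `R`. -/
abbrev quotF [NeZero c] : Type u := MvPolynomial (ZMod c) k ⧸ idealF k c

/-- The index set of the generators of the second module in a resolution of the residue field of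
`R`: the quadrics and the pairs of variables. -/
abbrev ColIndex : Type := GenIndex c ⊕ ZMod c × ZMod c

/-- The quadrics as combinations of the variables. -/
noncomputable def genLift : GenIndex c → ZMod c → MvPolynomial (ZMod c) k
  | Sum.inl i => Pi.single i (X i) - Pi.single (i - 3) (X (i - 1))
  | Sum.inr p => Pi.single p.1.2 (X p.1.1)

/-- The columns of the matrix of relations between the variables modulo the quadrics. -/
noncomputable def col : ColIndex c → ZMod c → MvPolynomial (ZMod c) k :=
  Sum.elim (genLift k c) (Koszul.relation k)

variable {k c}

theorem isHomogeneous_single {σ τ : Type*} [DecidableEq τ] (j : τ) (s : σ) (i : τ) :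
    ((Pi.single j (X s) : τ → MvPolynomial σ k) i).IsHomogeneous 1 := by
  rw [Pi.single_apply]
  split_ifs
  · exact isHomogeneous_X k s
  · exact isHomogeneous_zero _ _ _

theorem isHomogeneous_col (b : ColIndex c) (i : ZMod c) : (col k c b i).IsHomogeneous 1 := by
  match b with
  | Sum.inl (Sum.inl j) => exact (isHomogeneous_single _ _ _).sub (isHomogeneous_single _ _ _)
  | Sum.inl (Sum.inr p) => exact isHomogeneous_single _ _ _
  | Sum.inr p => exact (isHomogeneous_single _ _ _).sub (isHomogeneous_single _ _ _)

variable [NeZero c]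

theorem sum_single_mul_X (j s : ZMod c) :
    ∑ i, (Pi.single j (X s) : ZMod c → MvPolynomial (ZMod c) k) i * X i = X s * X j := by
  rw [Finset.sum_eq_single j]
  · rw [Pi.single_eq_same]
  · intro i _ hi
    rw [Pi.single_eq_of_ne hi, zero_mul]
  · simp

theorem sum_genLift_mul_X (a : GenIndex c) : ∑ i, genLift k c a i * X i = gens k c a := by
  match a with
  | Sum.inl j =>
    simp only [genLift, Pi.sub_apply, sub_mul, Finset.sum_sub_distrib, sum_single_mul_X, gens, sq]
  | Sum.inr p => exact sum_single_mul_X _ _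

theorem sum_relation_mul_X (b : ZMod c × ZMod c) :
    ∑ i, Koszul.relation k b i * X i = 0 := by
  simp only [Koszul.relation, Pi.sub_apply, sub_mul, Finset.sum_sub_distrib, sum_single_mul_X]
  ring

theorem sum_mul_sum_col (w : ColIndex c → MvPolynomial (ZMod c) k) :
    ∑ i, (∑ b, w b * col k c b i) * X i = ∑ a, w (Sum.inl a) * gens k c a := by
  simp only [Finset.sum_mul, mul_assoc]
  rw [Finset.sum_comm]
  simp only [← Finset.mul_sum]
  rw [Fintype.sum_sum_type]
  simp only [col, Sum.elim_inl, Sum.elim_inr, sum_genLift_mul_X, sum_relation_mul_X, mul_zero,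
    Finset.sum_const_zero, add_zero]

theorem mem_span_relation {p : ZMod c → MvPolynomial (ZMod c) k} (hp : ∑ i, p i * X i = 0) :
    p ∈ Submodule.span (MvPolynomial (ZMod c) k)
      (Set.range (Koszul.relation (σ := ZMod c) k)) := by
  let _ : LinearOrder (ZMod c) := LinearOrder.lift' ZMod.val (ZMod.val_injective c)
  convert Koszul.mem_span_relation hp

/-- After subtracting lifts of the quadrics, what remains is a syzygy on the variables. -/
theorem mem_span_col {p : ZMod c → MvPolynomial (ZMod c) k}
    (hp : ∑ i, p i * X i ∈ genIdeal k c) :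
    p ∈ Submodule.span (MvPolynomial (ZMod c) k) (Set.range (col k c)) := by
  obtain ⟨v, hv⟩ := Ideal.mem_span_range_iff_exists_fun.mp hp
  have h1 : p - ∑ a, v a • genLift k c a ∈ Submodule.span (MvPolynomial (ZMod c) k)
      (Set.range (Koszul.relation (σ := ZMod c) k)) := by
    apply mem_span_relation
    simp only [Pi.sub_apply, sub_mul, Finset.sum_sub_distrib, Finset.sum_apply, Pi.smul_apply,
      smul_eq_mul, Finset.sum_mul, mul_assoc]
    rw [Finset.sum_comm (f := fun x i => v i * (genLift k c i x * X x))]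
    simp only [← Finset.mul_sum, sum_genLift_mul_X]
    rw [hv, sub_self]
  have h2 : ∑ a, v a • genLift k c a ∈ Submodule.span (MvPolynomial (ZMod c) k)
      (Set.range (col k c)) :=
    sum_mem fun a _ => Submodule.smul_mem _ _ (Submodule.subset_span ⟨Sum.inl a, rfl⟩)
  rw [← sub_add_cancel p (∑ a, v a • genLift k c a)]
  refine add_mem (Submodule.span_mono ?_ h1) h2
  rintro _ ⟨b, rfl⟩
  exact ⟨Sum.inr b, rfl⟩

variable (k c) in
/-- The presentation of the irrelevant ideal of `R` by the variables. -/
noncomputable def varMap : (ZMod c → quotF k c) →ₗ[quotF k c] quotF k c :=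
  Fintype.linearCombination _ fun i => Ideal.Quotient.mk (idealF k c) (X i)

variable (k c) in
/-- The relations between the variables in `R`. -/
noncomputable def relMap : (ColIndex c → quotF k c) →ₗ[quotF k c] (ZMod c → quotF k c) :=
  Fintype.linearCombination _ fun b i => Ideal.Quotient.mk (idealF k c) (col k c b i)

theorem varMap_mk (p : ZMod c → MvPolynomial (ZMod c) k) :
    varMap k c (fun i => Ideal.Quotient.mk _ (p i)) =
      Ideal.Quotient.mk (idealF k c) (∑ i, p i * X i) := by
  simp [varMap, Fintype.linearCombination_apply]

theorem relMap_mk (w : ColIndex c → MvPolynomial (ZMod c) k) :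
    relMap k c (fun b => Ideal.Quotient.mk _ (w b)) =
      fun i => Ideal.Quotient.mk (idealF k c) (∑ b, w b * col k c b i) := by
  ext1 i
  simp only [relMap, Fintype.linearCombination_apply, Finset.sum_apply, Pi.smul_apply, map_sum,
    map_mul, smul_eq_mul]

theorem exists_lift {ι : Type*} (z : ι → quotF k c) :
    ∃ w : ι → MvPolynomial (ZMod c) k, z = fun b => Ideal.Quotient.mk _ (w b) := by
  choose w hw using fun b => Ideal.Quotient.mk_surjective (z b)
  exact ⟨w, funext fun b => (hw b).symm⟩

theorem exists_lift_gradingR {ι : Type*} {n : ℕ} {z : ι → quotF k c}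
    (hz : ∀ b, z b ∈ gradingR k c n) :
    ∃ w : ι → MvPolynomial (ZMod c) k, (∀ b, (w b).IsHomogeneous n) ∧
      z = fun b => Ideal.Quotient.mk _ (w b) := by
  choose w hw hw' using hz
  exact ⟨w, hw, funext fun b => (hw' b).symm⟩

theorem gradingR_mul {m n : ℕ} {x y : quotF k c} (hx : x ∈ gradingR k c m)
    (hy : y ∈ gradingR k c n) : x * y ∈ gradingR k c (m + n) := by
  obtain ⟨p, hp, rfl⟩ := hx
  obtain ⟨q, hq, rfl⟩ := hy
  exact ⟨p * q, IsHomogeneous.mul hp hq, map_mul (Ideal.Quotient.mkₐ k _) p q⟩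

theorem mk_C_mem_gradingR (r : k) : Ideal.Quotient.mk (idealF k c) (C r) ∈ gradingR k c 0 :=
  ⟨C r, isHomogeneous_C _ r, rfl⟩

theorem relMap_exact (hc : 7 ≤ c) : Function.Exact (relMap k c) (varMap k c) := by
  intro y
  constructor
  · intro h
    obtain ⟨p, rfl⟩ := exists_lift y
    rw [varMap_mk, Ideal.Quotient.eq_zero_iff_mem, idealF_eq_genIdeal hc] at h
    obtain ⟨w, hw⟩ := (Submodule.mem_span_range_iff_exists_fun _).mp (mem_span_col h)
    refine ⟨fun b => Ideal.Quotient.mk _ (w b), ?_⟩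
    rw [relMap_mk, ← hw]
    simp only [Finset.sum_apply, Pi.smul_apply, smul_eq_mul]
  · rintro ⟨w, rfl⟩
    obtain ⟨w, rfl⟩ := exists_lift w
    rw [relMap_mk, varMap_mk, Ideal.Quotient.eq_zero_iff_mem, sum_mul_sum_col]
    exact sum_mem fun a _ => Ideal.mul_mem_left _ _
      (genIdeal_le_idealF hc (Ideal.subset_span ⟨a, rfl⟩))

omit [NeZero c] in
theorem mem_span_X_of_isHomogeneous {p : MvPolynomial (ZMod c) k} {n : ℕ} (hn : 0 < n)
    (hp : p.IsHomogeneous n) : p ∈ Ideal.span (Set.range (X : ZMod c → MvPolynomial (ZMod c) k)) := by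
  have h := sub_C_constantCoeff_mem
    (J := Ideal.span (Set.range (X : ZMod c → MvPolynomial (ZMod c) k)))
    (fun i => Ideal.subset_span ⟨i, rfl⟩) p
  have h0 : constantCoeff p = 0 := hp.coeff_eq_zero (by simpa using hn.ne)
  simpa [h0] using h

theorem range_varMap : LinearMap.range (varMap k c) = irrelevantIdeal (gradingR k c) := by
  rw [varMap, Fintype.range_linearCombination]
  refine le_antisymm (Submodule.span_le.mpr ?_) (Submodule.span_le.mpr ?_)
  · rintro _ ⟨i, rfl⟩
    exact Ideal.subset_span ⟨1, one_pos, X i, isHomogeneous_X k i, rfl⟩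
  · rintro _ ⟨n, hn, p, hp, rfl⟩
    obtain ⟨s, hs⟩ := Ideal.mem_span_range_iff_exists_fun.mp (mem_span_X_of_isHomogeneous hn hp)
    refine (Submodule.mem_span_range_iff_exists_fun _).mpr
      ⟨fun i => Ideal.Quotient.mk _ (s i), ?_⟩
    simp [← hs]

theorem varMap_exact :
    Function.Exact (varMap k c) (Submodule.mkQ (irrelevantIdeal (gradingR k c))) := by
  intro y
  rw [← LinearMap.mem_ker, Submodule.ker_mkQ, ← range_varMap]
  rfl

/-- A form of degree `1` in `R` is a combination of the variables with constant coefficients. -/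
theorem exists_const_varMap {y : quotF k c} (hy : y ∈ gradingR k c 1) :
    ∃ r : ZMod c → k, varMap k c (fun i => Ideal.Quotient.mk _ (C (r i))) = y := by
  obtain ⟨p, hp, rfl⟩ := hy
  obtain ⟨r, hr⟩ := exists_const_combination_of_mem_span (q := X) (isHomogeneous_X k) hp
    (mem_span_X_of_isHomogeneous one_pos hp)
  refine ⟨r, ?_⟩
  rw [varMap_mk, ← hr]
  rfl

/-- A linear relation between the variables in `R` is a combination of the columns with constant
coefficients. -/
theorem exists_const_relMap (hc : 7 ≤ c) {y : ZMod c → quotF k c} (hy : ∀ i, y i ∈ gradingR k c 1)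
    (h0 : varMap k c y = 0) :
    ∃ r : ColIndex c → k, relMap k c (fun b => Ideal.Quotient.mk _ (C (r b))) = y := by
  obtain ⟨p, hp, rfl⟩ := exists_lift_gradingR hy
  rw [varMap_mk, Ideal.Quotient.eq_zero_iff_mem, idealF_eq_genIdeal hc] at h0
  obtain ⟨r, hr⟩ := exists_const_combination isHomogeneous_col hp (mem_span_col h0)
  refine ⟨r, ?_⟩
  rw [relMap_mk]
  simp only [← hr]

/-- A lift of a cycle to the polynomial ring yields a syzygy on the quadrics. -/
theorem isSyzygy_of_lift {w : ColIndex c → MvPolynomial (ZMod c) k}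
    {h : ZMod c → GenIndex c → MvPolynomial (ZMod c) k}
    (hw : ∀ i, ∑ b, w b * col k c b i = ∑ a, h i a * gens k c a) :
    IsSyzygy (gens k c) fun a => w (Sum.inl a) - ∑ i, X i * h i a := by
  have e := sum_mul_sum_col w
  simp only [hw] at e
  simp only [IsSyzygy, sub_mul, Finset.sum_sub_distrib, ← e, Finset.sum_mul]
  rw [Finset.sum_comm, sub_eq_zero]
  refine Finset.sum_congr rfl fun i _ => Finset.sum_congr rfl fun a _ => ?_
  ring

variable (k c) in
/-- The cycles with a lift whose associated syzygy lies in `avoidSubmodule k c 0`. -/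
noncomputable def liftable : Submodule (quotF k c) (ColIndex c → quotF k c) where
  carrier := {z | ∃ (w : ColIndex c → MvPolynomial (ZMod c) k)
    (h : ZMod c → GenIndex c → MvPolynomial (ZMod c) k),
    (z = fun b => Ideal.Quotient.mk _ (w b)) ∧
    (∀ i, ∑ b, w b * col k c b i = ∑ a, h i a * gens k c a) ∧
    (fun a => w (Sum.inl a) - ∑ i, X i * h i a) ∈ avoidSubmodule k c 0}
  zero_mem' := by
    refine ⟨0, 0, ?_, ?_, ?_⟩
    · ext1 b; simp
    · simp
    · have e : (fun a => (0 : ColIndex c → MvPolynomial (ZMod c) k) (Sum.inl a) -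
          ∑ i, X i * (0 : ZMod c → GenIndex c → MvPolynomial (ZMod c) k) i a) = 0 := by
        ext1 a
        simp
      rw [e]
      exact zero_mem _
  add_mem' := by
    rintro _ _ ⟨w, h, rfl, hw, hv⟩ ⟨w', h', rfl, hw', hv'⟩
    refine ⟨w + w', h + h', ?_, ?_, ?_⟩
    · ext1 b; simp
    · intro i
      simp only [Pi.add_apply, add_mul, Finset.sum_add_distrib, hw, hw']
    · convert add_mem hv hv' using 1
      ext1 a
      simp only [Pi.add_apply, mul_add, Finset.sum_add_distrib]
      ring
  smul_mem' := by
    rintro r _ ⟨w, h, rfl, hw, hv⟩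
    obtain ⟨s, rfl⟩ := Ideal.Quotient.mk_surjective r
    refine ⟨s • w, s • h, ?_, ?_, ?_⟩
    · ext1 b; simp
    · intro i
      simp only [Pi.smul_apply, smul_eq_mul, mul_assoc, ← Finset.mul_sum, hw]
    · convert Submodule.smul_mem _ s hv using 1
      ext1 a
      simp only [Pi.smul_apply, smul_eq_mul, mul_sub, Finset.mul_sum]
      congr 1
      exact Finset.sum_congr rfl fun i _ => by ring

/-- For a linear lift the correction terms are quadrics in I_F, hence constant combinations of the
generators; so the associated syzygy is linear. -/
theorem mem_liftable_of_linear (hc : 7 ≤ c) {z : ColIndex c → quotF k c}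
    (hz : ∀ b, z b ∈ gradingR k c 1) (h0 : relMap k c z = 0) : z ∈ liftable k c := by
  obtain ⟨w, hw, rfl⟩ := exists_lift_gradingR hz
  rw [relMap_mk] at h0
  have h (i : ZMod c) : ∃ r : GenIndex c → k,
      ∑ b, w b * col k c b i = ∑ a, C (r a) * gens k c a := by
    refine exists_const_combination_of_mem_span isHomogeneous_gens
      (IsHomogeneous.sum _ _ _ fun b _ => (hw b).mul (isHomogeneous_col b i)) ?_
    have := congrFun h0 i
    rw [Pi.zero_apply, Ideal.Quotient.eq_zero_iff_mem, idealF_eq_genIdeal hc] at this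
    exact this
  choose r hr using h
  refine ⟨w, fun i a => C (r i a), rfl, hr, linear_syzygy_mem hc (isSyzygy_of_lift hr) ?_ 0⟩
  intro a
  refine (hw _).sub (IsHomogeneous.sum _ _ _ fun i _ => ?_)
  simpa using (isHomogeneous_X k i).mul (isHomogeneous_C (ZMod c) (r i a))

/-- Any lift will do: scaling it by a variable scales its syzygy, which then passes the test. -/
theorem X_smul_mem_liftable (hc : 7 ≤ c) {z : ColIndex c → quotF k c}
    (h0 : relMap k c z = 0) (j : ZMod c) :
    Ideal.Quotient.mk (idealF k c) (X j) • z ∈ liftable k c := by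
  obtain ⟨w, rfl⟩ := exists_lift z
  rw [relMap_mk] at h0
  have h (i : ZMod c) : ∃ r : GenIndex c → MvPolynomial (ZMod c) k,
      ∑ b, w b * col k c b i = ∑ a, r a * gens k c a := by
    have := congrFun h0 i
    rw [Pi.zero_apply, Ideal.Quotient.eq_zero_iff_mem, idealF_eq_genIdeal hc] at this
    obtain ⟨r, hr⟩ := Ideal.mem_span_range_iff_exists_fun.mp this
    exact ⟨r, hr.symm⟩
  choose r hr using h
  refine ⟨(X j : MvPolynomial (ZMod c) k) • w, (X j : MvPolynomial (ZMod c) k) • r, ?_, ?_, ?_⟩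
  · ext1 b; simp
  · intro i
    simp only [Pi.smul_apply, smul_eq_mul, mul_assoc, ← Finset.mul_sum, hr]
  · convert X_smul_syzygy_mem hc (isSyzygy_of_lift hr) j 0 using 1
    ext1 a
    simp only [Pi.smul_apply, smul_eq_mul, mul_sub, Finset.mul_sum]
    congr 1
    exact Finset.sum_congr rfl fun i _ => by ring

theorem smul_ker_le_liftable (hc : 7 ≤ c) :
    irrelevantIdeal (gradingR k c) • LinearMap.ker (relMap k c) ≤ liftable k c := by
  refine Submodule.smul_le.mpr fun r hr z hz => ?_
  rw [← range_varMap] at hr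
  obtain ⟨p, rfl⟩ := hr
  rw [varMap, Fintype.linearCombination_apply, Finset.sum_smul]
  refine sum_mem fun i _ => ?_
  rw [smul_assoc]
  exact Submodule.smul_mem _ _ (X_smul_mem_liftable hc hz i)

variable (k c) in
/-- The cycle over the polynomial ring that extends `syzU`. -/
noncomputable def cycleU : ColIndex c → MvPolynomial (ZMod c) k :=
  Sum.elim (syzU k c) fun b => if b.1 = b.2 - 2 then -(X b.2 * X (b.2 - 1)) else 0

/-- The relation between x_{j-2} and x_j, with coefficient -x_j x_{j-1}, cancels the leading part of
the lift of q_j and, after a shift of j, the tail of the lift of the next quadric. -/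
theorem sum_cycleU_mul_col (i : ZMod c) : ∑ b, cycleU k c b * col k c b i = 0 := by
  let e (j : ZMod c) : MvPolynomial (ZMod c) k := if i = j then 1 else 0
  have he (j s : ZMod c) : (Pi.single j (X s) : ZMod c → MvPolynomial (ZMod c) k) i = X s * e j := by
    simp only [e, Pi.single_apply, mul_ite, mul_one, mul_zero]
  have h1 : ∑ a, cycleU k c (Sum.inl a) * col k c (Sum.inl a) i =
      ∑ j : ZMod c, X (j - 1) * X (j - 2) * (X j * e j - X (j - 1) * e (j - 3)) +
        ∑ p : {p : ZMod c × ZMod c // p.1.val < p.2.val ∧ 3 ≤ cycAbs c (p.1 - p.2)},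
          (0 : MvPolynomial (ZMod c) k) * (X p.1.1 * e p.1.2) := by
    simp only [← he]
    convert Fintype.sum_sum_type _ <;> rfl
  have h2 : ∑ b, cycleU k c (Sum.inr b) * col k c (Sum.inr b) i =
      ∑ j : ZMod c, -(X j * X (j - 1)) * (X (j - 2) * e j - X j * e (j - 2)) := by
    simp only [cycleU, col, Sum.elim_inr, Fintype.sum_prod_type_right, ite_mul, zero_mul,
      Finset.sum_ite_eq', Finset.mem_univ, if_true, Koszul.relation, Pi.sub_apply, he]
  have h3 : ∑ j : ZMod c, X j * X (j - 1) * (X j * e (j - 2)) =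
      ∑ j : ZMod c, X (j - 1) * X (j - 1 - 1) * (X (j - 1) * e (j - 1 - 2)) :=
    ((Equiv.subRight (1 : ZMod c)).sum_comp fun j => X j * X (j - 1) * (X j * e (j - 2))).symm
  rw [Fintype.sum_sum_type, h1, h2]
  simp only [zero_mul, Finset.sum_const_zero, add_zero, mul_sub, neg_mul, sub_neg_eq_add,
    Finset.sum_sub_distrib, Finset.sum_add_distrib, Finset.sum_neg_distrib, h3]
  rw [← sub_eq_zero_of_eq (show ∑ j : ZMod c, X (j - 1) * X (j - 2) * (X j * e j) =
    ∑ j : ZMod c, X j * X (j - 1) * (X (j - 2) * e j) from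
      Finset.sum_congr rfl fun j _ => by ring)]
  simp only [sub_sub, one_add_one_eq_two, show (1 + 2 : ZMod c) = 3 by norm_num]
  ring

theorem cycleU_notMem_liftable (hc : 7 ≤ c) :
    (fun b => Ideal.Quotient.mk (idealF k c) (cycleU k c b)) ∉ liftable k c := by
  classical
  rintro ⟨w, h, hz, hw, hv⟩
  have hδ (b : ColIndex c) : ∃ θ : GenIndex c → MvPolynomial (ZMod c) k,
      ∑ a, θ a * gens k c a = cycleU k c b - w b := by
    have := congrFun hz b
    rw [Ideal.Quotient.eq, idealF_eq_genIdeal hc] at this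
    exact Ideal.mem_span_range_iff_exists_fun.mp this
  choose θ hθ using hδ
  -- Two lifts of the cycle differ by θ times the generators. The corresponding change in h differs
  -- from this by syzygies s_i, so u is the tested syzygy plus ∑ x_i s_i plus a Koszul correction.
  let s : ZMod c → GenIndex c → MvPolynomial (ZMod c) k :=
    fun i a => h i a + ∑ b, θ b a * col k c b i
  have hs (i : ZMod c) : IsSyzygy (gens k c) (s i) := by
    have e : ∑ a, (∑ b, θ b a * col k c b i) * gens k c a =
        ∑ b, (cycleU k c b - w b) * col k c b i := by
      simp only [← hθ, Finset.sum_mul]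
      rw [Finset.sum_comm]
      exact Finset.sum_congr rfl fun b _ => Finset.sum_congr rfl fun a _ => by ring
    simp only [IsSyzygy, s, add_mul, Finset.sum_add_distrib, ← hw, e, sub_mul,
      Finset.sum_sub_distrib, sum_cycleU_mul_col]
    ring
  have hX : ∑ i, (X i : MvPolynomial (ZMod c) k) • s i ∈ avoidSubmodule k c 0 :=
    sum_mem fun i _ => X_smul_syzygy_mem hc (hs i) i 0
  have hK : ∑ a, ∑ b, θ (Sum.inl a) b • (Pi.single a (gens k c b) - Pi.single b (gens k c a)) ∈
      avoidSubmodule k c 0 :=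
    sum_mem fun a _ => sum_mem fun b _ => Submodule.smul_mem _ _ (koszul_syzygy_mem hc a b 0)
  refine syzU_notMem_avoidSubmodule (k := k) (c := c) 0 ?_
  convert add_mem (add_mem hv hX) hK using 1
  ext1 a
  have e1 : syzU k c a = w (Sum.inl a) + ∑ b, θ (Sum.inl a) b * gens k c b := by
    rw [hθ]
    simp [cycleU]
  have e2 : ∑ i, X i * s i a =
      ∑ i, X i * h i a + ∑ b, θ (Sum.inl b) a * gens k c b := by
    have := sum_mul_sum_col fun b => θ b a
    simp only [s, mul_add, Finset.sum_add_distrib]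
    rw [← this]
    simp only [mul_comm]
  have e3 : (∑ a, ∑ b, θ (Sum.inl a) b •
      (Pi.single a (gens k c b) - Pi.single b (gens k c a) :
        GenIndex c → MvPolynomial (ZMod c) k)) a =
      ∑ b, θ (Sum.inl a) b * gens k c b - ∑ b, θ (Sum.inl b) a * gens k c b := by
    simp only [Finset.sum_apply, Pi.smul_apply, Pi.sub_apply, smul_eq_mul, mul_sub,
      Finset.sum_sub_distrib, Pi.single_apply, mul_ite, mul_zero]
    congr 1
    · rw [Finset.sum_comm]
      exact Finset.sum_congr rfl fun b _ => by
        rw [Finset.sum_ite_eq, if_pos (Finset.mem_univ _)]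
    · exact Finset.sum_congr rfl fun b _ => by
        rw [Finset.sum_ite_eq, if_pos (Finset.mem_univ _)]
  rw [Pi.add_apply, Pi.add_apply, e3, Finset.sum_apply]
  simp only [Pi.smul_apply, smul_eq_mul]
  rw [e2, e1]
  ring

end NotKoszul

/-! ### A linear resolution would make the cycle liftable. -/

section NotKoszul

variable {k : Type u} [Field k] {c : ℕ} [NeZero c]

theorem linearCombination_mem_gradingR {ι τ : Type*} {m n : ℕ} {v : ι → τ → quotF k c}
    (hv : ∀ a t, v a t ∈ gradingR k c m) {f : ι →₀ quotF k c} (hf : ∀ a, f a ∈ gradingR k c n)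
    (t : τ) : Finsupp.linearCombination (quotF k c) v f t ∈ gradingR k c (n + m) := by
  rw [Finsupp.linearCombination_apply, Finsupp.sum, Finset.sum_apply]
  exact sum_mem fun a _ => gradingR_mul (hf a) (hv a t)

/-- The image of `cycleU` in `R` is a minimal cycle. -/
theorem mk_cycleU_mem_smul_top :
    (fun b => Ideal.Quotient.mk (idealF k c) (cycleU k c b)) ∈
      irrelevantIdeal (gradingR k c) • (⊤ : Submodule (quotF k c) (ColIndex c → quotF k c)) := by
  classical
  rw [← Finset.univ_sum_single fun b => Ideal.Quotient.mk (idealF k c) (cycleU k c b)]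
  refine sum_mem fun b _ => ?_
  have e (x : quotF k c) :
      Pi.single b x = x • (Pi.single b 1 : ColIndex c → quotF k c) := by
    ext1 a
    simp only [Pi.single_apply, Pi.smul_apply, smul_eq_mul, mul_ite, mul_one, mul_zero]
  rw [e]
  refine Submodule.smul_mem_smul (Ideal.subset_span ⟨2, two_pos, cycleU k c b, ?_, rfl⟩) trivial
  have h := isHomogeneous_X (σ := ZMod c) k
  match b with
  | Sum.inl a => exact isHomogeneous_syzU a
  | Sum.inr p =>
    show IsHomogeneous (if p.1 = p.2 - 2 then -(X p.2 * X (p.2 - 1)) else 0) 2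
    split_ifs
    · exact ((h _).mul (h _)).neg
    · exact isHomogeneous_zero _ _ _

theorem not_isKoszul_gradingR (hc : 7 ≤ c) : ¬ IsKoszul (gradingR k c) := by
  rintro ⟨F, hF⟩
  have hd (i : ℕ) (b : F.ι (i + 1)) (a : F.ι i) :
      F.d i (Finsupp.single b 1) a ∈ gradingR k c 1 := F.d_mem i b a 1 (by rw [hF, hF])
  have h0 (a : F.ι 0) : ∃ x : quotF k c, x ∈ gradingR k c 0 ∧
      Submodule.mkQ (irrelevantIdeal (gradingR k c)) x = F.ε (Finsupp.single a 1) := by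
    -- Linearity puts the generators in degree 0. Below, the comparison maps are likewise chosen
    -- with degree-0 entries, so that they preserve linearity of cycles.
    have := F.ε_mem a
    rwa [hF] at this
  choose v₀ hv₀ hε using h0
  let ψ₀ : (F.ι 0 →₀ quotF k c) →ₗ[quotF k c] quotF k c := Finsupp.linearCombination _ v₀
  have e₀ : Submodule.mkQ (irrelevantIdeal (gradingR k c)) ∘ₗ ψ₀ = F.ε :=
    Finsupp.lhom_ext' fun a => LinearMap.ext_ring (by simpa [ψ₀] using hε a)
  have h1 (b : F.ι 1) : ∃ r : ZMod c → k,
      varMap k c (fun i => Ideal.Quotient.mk _ (C (r i))) = ψ₀ (F.d 0 (Finsupp.single b 1)) := by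
    refine exists_const_varMap ?_
    rw [Finsupp.linearCombination_apply]
    exact sum_mem fun a _ => gradingR_mul (hd 0 b a) (hv₀ a)
  choose r₁ hr₁ using h1
  let ψ₁ : (F.ι 1 →₀ quotF k c) →ₗ[quotF k c] (ZMod c → quotF k c) :=
    Finsupp.linearCombination _ fun b i => Ideal.Quotient.mk _ (C (r₁ b i))
  have e₁ : varMap k c ∘ₗ ψ₁ = ψ₀ ∘ₗ F.d 0 :=
    Finsupp.lhom_ext' fun b => LinearMap.ext_ring (by simpa [ψ₁] using hr₁ b)
  have h2 (b : F.ι 2) : ∃ r : ColIndex c → k,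
      relMap k c (fun i => Ideal.Quotient.mk _ (C (r i))) = ψ₁ (F.d 1 (Finsupp.single b 1)) := by
    refine exists_const_relMap hc
      (linearCombination_mem_gradingR (fun _ _ => mk_C_mem_gradingR _) (hd 1 b)) ?_
    rw [← LinearMap.comp_apply, e₁, LinearMap.comp_apply, (F.exact_succ 0).apply_apply_eq_zero,
      map_zero]
  choose r₂ hr₂ using h2
  let ψ₂ : (F.ι 2 →₀ quotF k c) →ₗ[quotF k c] (ColIndex c → quotF k c) :=
    Finsupp.linearCombination _ fun b i => Ideal.Quotient.mk _ (C (r₂ b i))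
  have e₂ : relMap k c ∘ₗ ψ₂ = ψ₁ ∘ₗ F.d 1 :=
    Finsupp.lhom_ext' fun b => LinearMap.ext_ring (by simpa [ψ₂] using hr₂ b)
  -- The entries of `F.d 2` are linear and those of ψ₂ constant, so basis elements go to linear
  -- cycles.
  have hlift (f : F.ι 3 →₀ quotF k c) : ψ₂ (F.d 2 f) ∈ liftable k c := by
    induction f using Finsupp.induction_linear with
    | zero => simp
    | add f g hf hg => simpa using add_mem hf hg
    | single b r =>
      rw [← mul_one r, ← smul_eq_mul, ← Finsupp.smul_single, map_smul, map_smul]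
      refine Submodule.smul_mem _ _ (mem_liftable_of_linear hc
        (linearCombination_mem_gradingR (fun _ _ => mk_C_mem_gradingR _) (hd 2 b)) ?_)
      rw [← LinearMap.comp_apply (relMap k c), e₂, LinearMap.comp_apply,
        (F.exact_succ 1).apply_apply_eq_zero, map_zero]
  have hz : relMap k c (fun b => Ideal.Quotient.mk _ (cycleU k c b)) = 0 := by
    rw [relMap_mk]
    simp only [sum_cycleU_mul_col, map_zero]
    rfl
  obtain ⟨f, hf⟩ := exists_sub_mem_smul_ker F.ε_surjective F.exact_zero (F.exact_succ 0)
    (F.exact_succ 1) varMap_exact (relMap_exact hc) e₀ e₁ e₂ _ hz mk_cycleU_mem_smul_top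
  refine cycleU_notMem_liftable (k := k) hc ?_
  rw [← sub_add_cancel (fun b => Ideal.Quotient.mk (idealF k c) (cycleU k c b)) (ψ₂ (F.d 2 f))]
  exact add_mem (smul_ker_le_liftable hc hf) (hlift f)

end NotKoszul
end QuadGor

theorem mainTheorem4 (k : Type u) [Field k] (c : ℕ) [NeZero c] (hc : 7 ≤ c) :
    -- `R = S / I_F` is quadratic, Gorenstein, of codimension `c` and regularity `4`
    QuadGor.IsGeneratedByQuadrics (QuadGor.idealF k c) ∧
    QuadGor.IsGorensteinRing (MvPolynomial (ZMod c) k ⧸ QuadGor.idealF k c) ∧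
    (QuadGor.idealF k c).height = c ∧
    QuadGor.HasRegularity (QuadGor.polyGrading k c) (QuadGor.gradingR k c) 4 ∧
    QuadGor.HasHVector (QuadGor.gradingR k c) [1, c, 2 * c, c, 1] ∧
    -- `R` is not Koszul
    ¬ QuadGor.IsKoszul (QuadGor.gradingR k c) ∧
    -- the explicit quadrics minimally generate `I_F`, and `u` is a quadratic syzygy on them that
    -- is not generated by the linear and the Koszul syzygies
    QuadGor.idealF k c = Ideal.span (Set.range (QuadGor.gens k c)) ∧
    LinearIndependent k (QuadGor.gens k c) ∧
    QuadGor.IsSyzygy (QuadGor.gens k c) (QuadGor.syzU k c) ∧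
    (∀ a, (QuadGor.syzU k c a).IsHomogeneous 2) ∧
    QuadGor.syzU k c ∉ QuadGor.linearKoszulSyzygies (QuadGor.gens k c) :=
  ⟨QuadGor.isGeneratedByQuadrics_idealF hc, QuadGor.isGorensteinRing_quotient hc,
    QuadGor.height_idealF hc, QuadGor.hasRegularity_gradingR hc, QuadGor.hasHVector_gradingR hc,
    QuadGor.not_isKoszul_gradingR hc, QuadGor.idealF_eq_genIdeal hc,
    QuadGor.linearIndependent_gens hc, QuadGor.isSyzygy_syzU, QuadGor.isHomogeneous_syzU,
    QuadGor.syzU_notMem_linearKoszulSyzygies hc⟩
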